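/- Let $\sigma$ be a finite relational vocabulary and $k\in\mathbb{N}$. For a set $\mathbb{L}$ of formulas, $A\Rrightarrow_{\mathbb{L}}B$ means that every sentence of $\mathbb{L}$ true in the structure $A$ is true in the structure $B$; for pointed structures, $(A,a)\Rrightarrow_{\mathbb{L}}(B,b)$ means that every $\varphi(x)\in\mathbb{L}$ with $A\models\varphi(a)$ satisfies $B\models\varphi(b)$. An *existential* formula has no universal quantifiers (no modalities $\Box_R$, in the modal case) and negations only on atomic formulas. Let - $\exists\mathrm{FO}_k$ be the existential first-order formulas (with equality) of quantifier rank at most $k$; - $\exists\mathcal{L}^k$ (for $k\ge 1$) be the existential formulas of infinitary logic (with equality and with conjunctions and disjunctions of arbitrary set size) that use only the variables $x_1,\dots,x_k$, free or bound; - $\exists\mathrm{ML}_k$ be the existential modal formulas of modal depth at most $k$, with a propositional variable for each unary and modalities $\Diamond_R,\Box_R$ for each binary $R\in\sigma$, under Kripke semantics. Write $\sqsubseteq$ for the prefix order on finite sequences. Over any relational vocabulary consider the following comonads, whose counit $\epsilon$ sends a sequence to its last element. - $\mathbb{E}_kA$ is the set of non-empty sequences of elements of $A$ of length at most $k$. A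 relation $R$ holds of $(s_1,\dots,s_n)$ iff the $s_i$ are pairwise $\sqsubseteq$-comparable and $R^A(\epsilon s_1,\dots,\epsilon s_n)$. The coextension of $f\colon\mathbb{E}_kA\to B$ is $f^*[a_1,\dots,a_i]=[b_1,\dots,b_i]$ with $b_l=f[a_1,\dots,a_l]$. - $\mathbb{P}_kA$ is the set of all finite non-empty sequences of moves $(p,a)$ with $p\in\{1,\dots,k\}$, $a\in A$ (here $\epsilon$ is the element of the last move). A relation $R$ holds of $(s_1,\dots,s_n)$ iff the previous condition holds and, whenever $s_i\sqsubseteq s_j$, the pebble index of the last move of $s_i$ does not occur in the suffix of $s_i$ in $s_j$. Coextension is as before, keeping the pebble indices. - If all symbols have arity at most $2$, $\mathbb{M}_k(A,a)$ is the set of paths $a=a_0\xrightarrow{R_1}a_1\cdots\xrightarrow{R_i}a_i$ with $i\le k$, $R_j\in\sigma$ binary and $R_j^A(a_{j-1},a_j)$, pointed at the trivial path. A unary symbol holds of a path iff it holds of its last element; a binary symbol $R$ relates $s$ to $t$ iff $t$ extends $s$ by one step along $R$; nothing else holds. The coextension of $f$ sends the path above to $b_0\xrightarrow{R_1}b_1\cdots\xrightarrow{R_i}b_i$,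 where $b_l$ is the value of $f$ at its initial segment of length $l$. For a comonad $G$, let $\mathrm{EM}(G)$ be its category of coalgebras. A coalgebra $\alpha\colon X\to GX$ of one of these comonads is ordered by $x\le y$ iff $\alpha(x)\sqsubseteq\alpha(y)$, where a path in $\mathbb{M}_k$ is identified with the sequence of its steps $(R_j,a_j)$. It is a *path* if this order is finite and linear (the empty coalgebra of $\mathbb{E}_k$ or $\mathbb{P}_k$ is allowed). A morphism of coalgebras is an *embedding* if it is injective and reflects all relations; a *path embedding* is an embedding whose domain is a path; a morphism $f\colon X\to Y$ is a *pathwise embedding* if $f\circ m$ is a path embedding for every path embedding $m\colon P\to X$. Let $\mathbb{E}^I_k,\mathbb{P}^I_k$ be the comonads $\mathbb{E}_k,\mathbb{P}_k$ over $\sigma^I=\sigma\cup\{I\}$, with $I$ a new binary symbol. Let $J(A)$ be $A$ with $I$ interpreted as equality, and let $F^I_k(A)$ be the co-free coalgebra on $J(A)$. Let $F_k(A,a)$ be the co-free $\mathbb{M}_k$-coalgebra on $(A,a)$. **Theorem.** 1. For all $\sigma$-structures $A,B$: $A\Rrightarrow_{\exists\mathrm{FO}_k}B$ if and only if there is a pathwise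 embedding $F^I_k(A)\to F^I_k(B)$ in $\mathrm{EM}(\mathbb{E}^I_k)$. 2. If $k\ge 1$, for all $\sigma$-structures $A,B$: $A\Rrightarrow_{\exists\mathcal{L}^k}B$ if and only if there is a pathwise embedding $F^I_k(A)\to F^I_k(B)$ in $\mathrm{EM}(\mathbb{P}^I_k)$. 3. If all symbols of $\sigma$ have arity at most $2$, for all pointed $\sigma$-structures $(A,a),(B,b)$: $(A,a)\Rrightarrow_{\exists\mathrm{ML}_k}(B,b)$ if and only if there is a pathwise embedding $F_k(A,a)\to F_k(B,b)$ in $\mathrm{EM}(\mathbb{M}_k)$. -/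

import Mathlib

open FirstOrder CategoryTheory

universe u v w

namespace GameComonads

/-! ### Comonads in Kleisli form -/

/-- A comonad in Kleisli form: an object map, counits, and a coextension operation. -/
structure KleisliComonad (C : Type u) [Category.{v} C] where
  G : C → C
  ε : ∀ A, G A ⟶ A
  coext : ∀ {A B}, (G A ⟶ B) → (G A ⟶ G B)
  coext_counit : ∀ A, coext (ε A) = 𝟙 (G A)
  coext_comp_counit : ∀ {A B} (f : G A ⟶ B), coext f ≫ ε B = f
  coext_coext : ∀ {A B D} (f : G A ⟶ B) (g : G B ⟶ D),
    coext (coext f ≫ g) = coext f ≫ coext g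

/-- The comonad induced by a comonad in Kleisli form:
`G f = (f ∘ ε)^*` and `δ_A = (id_{G A})^*`. -/
def KleisliComonad.toComonad {C : Type u} [Category.{v} C] (K : KleisliComonad C) :
    Comonad C where
  obj := K.G
  map f := K.coext (K.ε _ ≫ f)
  map_id A := by simp [K.coext_counit]
  map_comp f g := by
    rw [← K.coext_coext, ← Category.assoc (K.coext _), K.coext_comp_counit, Category.assoc]
  ε :=
    { app := K.ε
      naturality := fun _ _ f => K.coext_comp_counit _ }
  δ :=
    { app := fun A => K.coext (𝟙 (K.G A))
      naturality := fun A B f => by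
        simp only [Functor.comp_map]
        rw [← K.coext_coext, ← K.coext_coext, ← Category.assoc, K.coext_comp_counit]
        simp }
  coassoc A := by
    simp only
    rw [← K.coext_coext, ← K.coext_coext, ← Category.assoc, K.coext_comp_counit]
    simp
  left_counit A := K.coext_comp_counit _
  right_counit A := by
    simp only
    rw [← K.coext_coext, ← Category.assoc, K.coext_comp_counit]
    simpa using K.coext_counit A

/-- Pathwise embeddings between coalgebras, for a given notion of embedding in the base category
and a given notion of path among the coalgebras: morphisms whose composite with each path embedding
is a path embedding. -/
def IsPathwiseEmbedding {C : Type u} [Category.{v} C] {G : Comonad C}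
    (Emb : MorphismProperty C) (IsPath : G.Coalgebra → Prop) {X Y : G.Coalgebra}
    (f : X ⟶ Y) : Prop :=
  ∀ P : G.Coalgebra, IsPath P → ∀ m : P ⟶ X, Emb m.f → Emb (m ≫ f).f

/-! ### Structures -/

/-- `σ`-structures. -/
structure Str (σ : FirstOrder.Language.{0, 0}) where
  carrier : Type u
  [str : σ.Structure carrier]

attribute [instance] Str.str

/-- The category of `σ`-structures and homomorphisms. -/
instance (σ : FirstOrder.Language.{0, 0}) : Category (Str.{u} σ) where
  Hom A B := A.carrier →[σ] B.carrier
  id A := Language.Hom.id σ A.carrier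
  comp f g := g.comp f

/-- Embeddings of structures: injective homomorphisms that reflect the relations. -/
def StrEmb (σ : FirstOrder.Language.{0, 0}) : MorphismProperty (Str.{u} σ) :=
  fun A B (f : A.carrier →[σ] B.carrier) =>
    Function.Injective f ∧
      ∀ (n : ℕ) (R : σ.Relations n) (x : Fin n → A.carrier),
        Language.Structure.RelMap R (fun i => f (x i)) → Language.Structure.RelMap R x

/-- Pointed `σ`-structures. -/
structure PStr (σ : FirstOrder.Language.{0, 0}) where
  toStr : Str.{u} σ
  pt : toStr.carrier

/-- The category of pointed `σ`-structures and homomorphisms preserving the distinguished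
elements. -/
instance (σ : FirstOrder.Language.{0, 0}) : Category (PStr.{u} σ) where
  Hom A B := {f : A.toStr.carrier →[σ] B.toStr.carrier // f A.pt = B.pt}
  id A := ⟨Language.Hom.id σ A.toStr.carrier, rfl⟩
  comp f g := ⟨g.1.comp f.1, by rw [Language.Hom.comp_apply, f.2, g.2]⟩

/-- Embeddings of pointed structures. -/
def PStrEmb (σ : FirstOrder.Language.{0, 0}) : MorphismProperty (PStr.{u} σ) :=
  fun A B (f : {f : A.toStr.carrier →[σ] B.toStr.carrier // f A.pt = B.pt}) =>
    StrEmb σ (show A.toStr ⟶ B.toStr from f.1)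

/-! ### The identity relation symbol -/

/-- The relation symbols of the vocabulary `{I}`. -/
inductive IRel : ℕ → Type
  | I : IRel 2

/-- The vocabulary `{I}`, with `I` a binary relation symbol. -/
def identityLang : FirstOrder.Language.{0, 0} := ⟨fun _ => Empty, IRel⟩

instance : identityLang.IsRelational := fun _ => inferInstanceAs (IsEmpty Empty)

/-- The vocabulary `σ^I = σ ∪ {I}`. -/
abbrev withI (σ : FirstOrder.Language.{0, 0}) : FirstOrder.Language.{0, 0} := σ.sum identityLang

/-- The interpretation of `I` as the diagonal. -/
@[reducible] def diagonalStructure (A : Type u) : identityLang.Structure A where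
  funMap f := (f : Empty).elim
  RelMap R x := match R, x with
    | IRel.I, x => x 0 = x 1

/-- The `σ^I`-structure `J(A)`: the `σ`-structure `A`, with `I` interpreted as the diagonal. -/
def addI {σ : FirstOrder.Language.{0, 0}} (A : Str.{u} σ) : Str.{u} (withI σ) :=
  letI := diagonalStructure A.carrier
  { carrier := A.carrier
    str := Language.sumStructure σ identityLang A.carrier }

/-! ### The Ehrenfeucht–Fraïssé comonad -/

section EF

variable {σ : FirstOrder.Language.{0, 0}} [σ.IsRelational] {k : ℕ}

/-- Non-empty sequences of elements of `A` of length at most `k`. -/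
def ESeq (k : ℕ) (A : Type u) : Type u := {s : List A // s ≠ [] ∧ s.length ≤ k}

/-- The last element of a sequence. -/
def ESeq.last {A : Type u} (s : ESeq k A) : A := s.1.getLast s.2.1

/-- The non-empty prefix of length `i + 1` of a sequence. -/
def ESeq.pre {A : Type u} (s : ESeq k A) (i : Fin s.1.length) : ESeq k A :=
  ⟨s.1.take (i + 1), by
    have h := s.2.1
    simp [h], (List.length_take_le' _ _).trans s.2.2⟩

instance (A : Type u) [σ.Structure A] : σ.Structure (ESeq k A) where
  funMap f := isEmptyElim f
  RelMap R s := (∀ i j, (s i).1 <+: (s j).1 ∨ (s j).1 <+: (s i).1) ∧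
    Language.Structure.RelMap R (fun i => (s i).last)

/-- `f^*[a_1, …, a_i] = [b_1, …, b_i]` with `b_l = f[a_1, …, a_l]`. -/
def ESeq.coext {A B : Type u} (f : ESeq k A → B) (s : ESeq k A) : ESeq k B :=
  ⟨List.ofFn fun i => f (s.pre i), by
    have h := s.2.1
    simp [h], by simpa using s.2.2⟩

theorem ESeq.last_pre {A : Type u} (s : ESeq k A) (i : Fin s.1.length) :
    (s.pre i).last = s.1[i] := by
  have h := i.2
  simp only [ESeq.last, ESeq.pre, List.getLast_eq_getElem, List.getElem_take, List.length_take]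
  congr 1
  omega

theorem ESeq.last_coext {A B : Type u} (f : ESeq k A → B) (s : ESeq k A) :
    (s.coext f).last = f s := by
  have h := List.length_pos_iff.2 s.2.1
  simp only [ESeq.last, ESeq.coext, List.getLast_eq_getElem, List.getElem_ofFn, List.length_ofFn]
  congr 1
  apply Subtype.ext
  simp only [ESeq.pre]
  rw [List.take_of_length_le]
  omega

theorem ESeq.coext_prefix {A B : Type u} (f : ESeq k A → B) {s t : ESeq k A}
    (h : s.1 <+: t.1) : (s.coext f).1 <+: (t.coext f).1 := by
  have hl := h.length_le
  rw [List.prefix_iff_eq_take]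
  apply List.ext_getElem
  · simp [ESeq.coext, hl]
  · intro i h1 h2
    simp only [ESeq.coext, List.getElem_ofFn, List.getElem_take]
    congr 1
    apply Subtype.ext
    simp only [ESeq.pre]
    simp only [ESeq.coext, List.length_ofFn] at h1
    obtain ⟨w, hw⟩ := h
    rw [← hw, List.take_append_of_le_length (by omega)]

theorem ESeq.pre_coext {A B : Type u} (f : ESeq k A → B) (s : ESeq k A)
    (i : Fin s.1.length) :
    (s.coext f).pre ⟨i, i.2.trans_eq List.length_ofFn.symm⟩ = (s.pre i).coext f := by
  apply Subtype.ext
  have h0 : (s.pre i).1 <+: s.1 := List.take_prefix _ _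
  rw [List.prefix_iff_eq_take.1 (ESeq.coext_prefix f h0)]
  have := i.2
  simp only [ESeq.coext, ESeq.pre, List.length_ofFn, List.length_take]
  congr 1
  omega

/-- The Ehrenfeucht–Fraïssé comonad in Kleisli form. -/
def EKleisli (σ : FirstOrder.Language.{0, 0}) [σ.IsRelational] (k : ℕ) :
    KleisliComonad (Str.{u} σ) where
  G A := ⟨ESeq k A.carrier⟩
  ε A :=
    { toFun := ESeq.last
      map_fun' := fun f => isEmptyElim f
      map_rel' := fun _ _ h => h.2 }
  coext {A B} (f : ESeq k A.carrier →[σ] B.carrier) :=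
    { toFun := ESeq.coext f
      map_fun' := fun g => isEmptyElim g
      map_rel' := fun R s h => by
        refine ⟨fun i j => (h.1 i j).imp (ESeq.coext_prefix f) (ESeq.coext_prefix f), ?_⟩
        simp only [Function.comp_apply, ESeq.last_coext]
        exact f.map_rel R s h }
  coext_counit A := by
    apply Language.Hom.ext
    intro (s : ESeq k A.carrier)
    apply Subtype.ext
    apply List.ext_getElem
    · exact List.length_ofFn
    · intro i h1 h2
      exact (List.getElem_ofFn _).trans (s.last_pre ⟨i, h2⟩)
  coext_comp_counit {A B} f := by
    apply Language.Hom.ext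
    intro (s : ESeq k A.carrier)
    exact ESeq.last_coext _ s
  coext_coext {A B D} f g := by
    apply Language.Hom.ext
    intro (s : ESeq k A.carrier)
    apply Subtype.ext
    apply List.ext_getElem
    · exact List.length_ofFn.trans (List.length_ofFn.trans List.length_ofFn).symm
    · intro i h1 h2
      have h3 : i < s.1.length := lt_of_lt_of_eq h1 List.length_ofFn
      refine (List.getElem_ofFn _).trans (Eq.trans ?_ (List.getElem_ofFn _).symm)
      exact congrArg (fun t => (show ESeq k B.carrier →[σ] D.carrier from g) t)
        (ESeq.pre_coext _ s ⟨i, h3⟩).symm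

end EF

/-! ### The pebbling comonad -/

section Pebbling

variable {σ : FirstOrder.Language.{0, 0}} [σ.IsRelational] {k : ℕ}

/-- Non-empty finite sequences of moves `(p, a)`, with `p` one of `k` pebbles and `a` in `A`. -/
def PSeq (k : ℕ) (A : Type u) : Type u := {s : List (Fin k × A) // s ≠ []}

/-- The last move of a sequence. -/
def PSeq.lastMove {A : Type u} (s : PSeq k A) : Fin k × A := s.1.getLast s.2

/-- The element selected in the last move. -/
def PSeq.last {A : Type u} (s : PSeq k A) : A := s.lastMove.2

/-- The pebble index of the last move. -/
def PSeq.pebble {A : Type u} (s : PSeq k A) : Fin k := s.lastMove.1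

/-- The non-empty prefix of length `i + 1` of a sequence. -/
def PSeq.pre {A : Type u} (s : PSeq k A) (i : Fin s.1.length) : PSeq k A :=
  ⟨s.1.take (i + 1), by
    have h := s.2
    simp [h]⟩

instance (A : Type u) [σ.Structure A] : σ.Structure (PSeq k A) where
  funMap f := isEmptyElim f
  RelMap R s := (∀ i j, (s i).1 <+: (s j).1 ∨ (s j).1 <+: (s i).1) ∧
    Language.Structure.RelMap R (fun i => (s i).last) ∧
    ∀ i j, ∀ w, (s i).1 ++ w = (s j).1 → (s i).pebble ∉ w.map Prod.fst

/-- `f^*[(p_1, a_1), …, (p_i, a_i)] = [(p_1, b_1), …, (p_i, b_i)]` with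
`b_l = f[(p_1, a_1), …, (p_l, a_l)]`. -/
def PSeq.coext {A B : Type u} (f : PSeq k A → B) (s : PSeq k A) : PSeq k B :=
  ⟨List.ofFn fun i => (s.1[i].1, f (s.pre i)), by
    have h := s.2
    simp [h]⟩

theorem PSeq.lastMove_pre {A : Type u} (s : PSeq k A) (i : Fin s.1.length) :
    (s.pre i).lastMove = s.1[i] := by
  have h := i.2
  simp only [PSeq.lastMove, PSeq.pre, List.getLast_eq_getElem, List.getElem_take,
    List.length_take]
  congr 1
  omega

theorem PSeq.lastMove_coext {A B : Type u} (f : PSeq k A → B) (s : PSeq k A) :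
    (s.coext f).lastMove = (s.pebble, f s) := by
  have h := List.length_pos_iff.2 s.2
  simp only [PSeq.lastMove, PSeq.pebble, PSeq.coext, List.getLast_eq_getElem, List.getElem_ofFn,
    List.length_ofFn]
  congr 2
  apply Subtype.ext
  simp only [PSeq.pre]
  rw [List.take_of_length_le]
  omega

theorem PSeq.coext_prefix {A B : Type u} (f : PSeq k A → B) {s t : PSeq k A}
    (h : s.1 <+: t.1) : (s.coext f).1 <+: (t.coext f).1 := by
  have hl := h.length_le
  rw [List.prefix_iff_eq_take]
  apply List.ext_getElem
  · simp [PSeq.coext, hl]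
  · intro i h1 h2
    simp only [PSeq.coext, List.length_ofFn] at h1
    obtain ⟨w, hw⟩ := h
    have e1 : t.1[i]'(h1.trans_le hl) = s.1[i] := by
      simp only [← hw]
      exact List.getElem_append_left h1
    have e2 : t.pre ⟨i, h1.trans_le hl⟩ = s.pre ⟨i, h1⟩ := by
      apply Subtype.ext
      simp only [PSeq.pre]
      rw [← hw, List.take_append_of_le_length (by omega)]
    simp only [PSeq.coext, List.getElem_ofFn, List.getElem_take, Fin.getElem_fin, e1, e2]

theorem PSeq.pre_coext {A B : Type u} (f : PSeq k A → B) (s : PSeq k A)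
    (i : Fin s.1.length) :
    (s.coext f).pre ⟨i, i.2.trans_eq List.length_ofFn.symm⟩ = (s.pre i).coext f := by
  apply Subtype.ext
  have h0 : (s.pre i).1 <+: s.1 := List.take_prefix _ _
  rw [List.prefix_iff_eq_take.1 (PSeq.coext_prefix f h0)]
  have := i.2
  simp only [PSeq.coext, PSeq.pre, List.length_ofFn, List.length_take]
  congr 1
  omega

theorem PSeq.map_fst_coext {A B : Type u} (f : PSeq k A → B) (s : PSeq k A) :
    (s.coext f).1.map Prod.fst = s.1.map Prod.fst := by
  apply List.ext_getElem <;> simp [PSeq.coext]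

/-- The pebbling comonad in Kleisli form. -/
def PKleisli (σ : FirstOrder.Language.{0, 0}) [σ.IsRelational] (k : ℕ) :
    KleisliComonad (Str.{u} σ) where
  G A := ⟨PSeq k A.carrier⟩
  ε A :=
    { toFun := PSeq.last
      map_fun' := fun f => isEmptyElim f
      map_rel' := fun _ _ h => h.2.1 }
  coext {A B} (f : PSeq k A.carrier →[σ] B.carrier) :=
    { toFun := PSeq.coext f
      map_fun' := fun g => isEmptyElim g
      map_rel' := fun R s h => by
        refine ⟨fun i j => (h.1 i j).imp (PSeq.coext_prefix f) (PSeq.coext_prefix f), ?_, ?_⟩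
        · simp only [Function.comp_apply, PSeq.last, PSeq.lastMove_coext]
          exact f.map_rel R s h
        · intro i j w hw
          simp only [Function.comp_apply, PSeq.pebble, PSeq.lastMove_coext] at hw ⊢
          have hw' := congrArg (List.map Prod.fst) hw
          rw [List.map_append, PSeq.map_fst_coext, PSeq.map_fst_coext] at hw'
          rcases h.1 i j with ⟨z, hz⟩ | hp
          · have := h.2.2 i j z hz
            rw [← hz, List.map_append, List.append_cancel_left_eq] at hw'
            rwa [hw']
          · have h1 := hp.length_le
            have h2 := congrArg List.length hw'
            simp only [List.length_append, List.length_map] at h2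
            have h3 : w = [] := List.length_eq_zero_iff.1 (by omega)
            simp [h3] }
  coext_counit A := by
    apply Language.Hom.ext
    intro (s : PSeq k A.carrier)
    apply Subtype.ext
    apply List.ext_getElem
    · exact List.length_ofFn
    · intro i h1 h2
      refine (List.getElem_ofFn _).trans (Prod.ext rfl ?_)
      have h3 : i < s.1.length := h2
      have h4 : (s.pre ⟨i, h3⟩).lastMove.2 = s.1[i].2 :=
        congrArg Prod.snd (s.lastMove_pre ⟨i, h3⟩)
      exact h4
  coext_comp_counit {A B} f := by
    apply Language.Hom.ext
    intro (s : PSeq k A.carrier)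
    exact congrArg Prod.snd (PSeq.lastMove_coext _ s)
  coext_coext {A B D} f g := by
    apply Language.Hom.ext
    intro (s : PSeq k A.carrier)
    apply Subtype.ext
    apply List.ext_getElem
    · exact List.length_ofFn.trans (List.length_ofFn.trans List.length_ofFn).symm
    · intro i h1 h2
      have h3 : i < s.1.length := lt_of_lt_of_eq h1 List.length_ofFn
      refine (List.getElem_ofFn _).trans (Eq.trans ?_ (List.getElem_ofFn _).symm)
      refine Prod.ext (congrArg Prod.fst (List.getElem_ofFn
        (f := fun i : Fin s.1.length => (s.1[i].1, f.toFun (s.pre i))) _)).symm ?_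
      exact congrArg (fun t => (show PSeq k B.carrier →[σ] D.carrier from g) t)
        (PSeq.pre_coext _ s ⟨i, h3⟩).symm

end Pebbling

/-! ### The modal comonad -/

section Modal

variable {σ : FirstOrder.Language.{0, 0}} [σ.IsRelational] {k : ℕ}

/-- The last element of the path that starts at `a` and takes the steps in the list `l`. -/
def walkLast {A : Type u} (a : A) (l : List (σ.Relations 2 × A)) : A :=
  (l.getLast?.map Prod.snd).getD a

/-- The paths of length at most `k` that start at `a`. The path
`a = a_0 -R_1→ a_1 -R_2→ ⋯ -R_i→ a_i` is recorded as the list `[(R_1, a_1), …, (R_i, a_i)]`. -/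
def MSeq (k : ℕ) (A : Type u) [σ.Structure A] (a : A) : Type u :=
  {l : List (σ.Relations 2 × A) // l.length ≤ k ∧
    ∀ (j : ℕ) (hj : j < l.length),
      Language.Structure.RelMap l[j].1 ![walkLast a (l.take j), l[j].2]}

variable {A B : Type u} [σ.Structure A] [σ.Structure B] {a : A} {b : B}

/-- The last element of a path. -/
def MSeq.last (s : MSeq (σ := σ) k A a) : A := walkLast a s.1

/-- The trivial path. -/
def MSeq.root (k : ℕ) (a : A) : MSeq (σ := σ) k A a :=
  ⟨[], Nat.zero_le _, fun j hj => absurd hj (Nat.not_lt_zero j)⟩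

/-- The initial segment of length `min i s.length` of a path. -/
def MSeq.pre (s : MSeq (σ := σ) k A a) (i : ℕ) : MSeq (σ := σ) k A a :=
  ⟨s.1.take i, (List.length_take_le' _ _).trans s.2.1, fun j hj => by
    rw [List.length_take] at hj
    have h := s.2.2 j (by omega)
    rw [List.getElem_take, List.take_take, min_eq_left (by omega)]
    exact h⟩

/-- The unravelling. A unary symbol holds of a path if it holds of its last element; a binary
symbol `R` relates `s` to `t` if `t` extends `s` by one step along `R`; nothing else holds. -/
instance (k : ℕ) (a : A) : σ.Structure (MSeq (σ := σ) k A a) where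
  funMap f := isEmptyElim f
  RelMap {n} R s := match n, R, s with
    | 1, P, s => Language.Structure.RelMap P ![(s 0).last]
    | 2, R, s => ∃ x, (s 1).1 = (s 0).1 ++ [(R, x)]
    | _, _, _ => False

theorem walkLast_take_succ {σ : FirstOrder.Language.{0, 0}} {A : Type u} (a : A)
    (l : List (σ.Relations 2 × A)) (j : ℕ) (hj : j < l.length) :
    walkLast a (l.take (j + 1)) = l[j].2 := by
  rw [List.take_succ_eq_append_getElem hj, walkLast, List.getLast?_append_of_ne_nil _ (by simp)]
  simp

/-- The underlying list of the coextension: `a_0 -R_1→ ⋯ -R_i→ a_i` is sent to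
`b_0 -R_1→ ⋯ -R_i→ b_i` with `b_l = f(a_0 -R_1→ ⋯ -R_l→ a_l)`. -/
def MSeq.coextList (f : MSeq (σ := σ) k A a → B) (s : MSeq (σ := σ) k A a) :
    List (σ.Relations 2 × B) :=
  List.ofFn fun i : Fin s.1.length => (s.1[i].1, f (s.pre (i + 1)))

set_option linter.unusedSectionVars false in
theorem MSeq.length_coextList (f : MSeq (σ := σ) k A a → B) (s : MSeq (σ := σ) k A a) :
    (s.coextList f).length = s.1.length := List.length_ofFn

theorem MSeq.walkLast_take_coextList (f : MSeq (σ := σ) k A a → B) (hf : f (MSeq.root k a) = b)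
    (s : MSeq (σ := σ) k A a) (j : ℕ) (hj : j ≤ s.1.length) :
    walkLast b ((s.coextList f).take j) = f (s.pre j) := by
  cases j with
  | zero =>
    have h : s.pre 0 = MSeq.root k a := Subtype.ext (List.take_zero (l := s.1))
    rw [h, hf]
    simp [walkLast]
  | succ j =>
    rw [walkLast_take_succ _ _ _ (by rw [MSeq.length_coextList]; omega)]
    simp [MSeq.coextList]

set_option linter.unusedSectionVars false in
theorem MSeq.pre_length (s : MSeq (σ := σ) k A a) : s.pre s.1.length = s :=
  Subtype.ext List.take_length

/-- The coextension of a homomorphism from an unravelling, as a function. -/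
def MSeq.coext (f : MSeq (σ := σ) k A a →[σ] B) (hf : f (MSeq.root k a) = b)
    (s : MSeq (σ := σ) k A a) : MSeq (σ := σ) k B b :=
  ⟨s.coextList f, (s.length_coextList f).trans_le s.2.1, fun j hj => by
    rw [MSeq.length_coextList] at hj
    rw [MSeq.walkLast_take_coextList f hf s j hj.le]
    simp only [MSeq.coextList, List.getElem_ofFn, Fin.getElem_fin]
    have h : Language.Structure.RelMap s.1[j].1 ![s.pre j, s.pre (j + 1)] :=
      ⟨s.1[j].2, List.take_succ_eq_append_getElem hj⟩
    have h' := f.map_rel _ _ h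
    have e : f ∘ ![s.pre j, s.pre (j + 1)] = ![f (s.pre j), f (s.pre (j + 1))] := by
      funext i
      fin_cases i <;> rfl
    rwa [e] at h'⟩

theorem MSeq.last_coext (f : MSeq (σ := σ) k A a →[σ] B) (hf : f (MSeq.root k a) = b)
    (s : MSeq (σ := σ) k A a) : (s.coext f hf).last = f s := by
  have h := s.walkLast_take_coextList f hf _ le_rfl
  rw [List.take_of_length_le (s.length_coextList f).le, s.pre_length] at h
  exact h

theorem MSeq.pre_coext (f : MSeq (σ := σ) k A a →[σ] B) (hf : f (MSeq.root k a) = b)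
    (s : MSeq (σ := σ) k A a) (j : ℕ) :
    (s.coext f hf).pre j = (s.pre j).coext f hf := by
  apply Subtype.ext
  apply List.ext_getElem
  · simp [MSeq.coext, MSeq.pre, MSeq.coextList]
  · intro i h1 h2
    have h3 := (MSeq.length_coextList f _).symm.trans_gt h2
    simp only [MSeq.pre, List.length_take] at h3
    simp only [MSeq.coext, MSeq.pre, MSeq.coextList, List.getElem_take, List.getElem_ofFn,
      Fin.getElem_fin]
    have e : (s.pre j).pre (i + 1) = s.pre (i + 1) := by
      apply Subtype.ext
      simp only [MSeq.pre]
      rw [List.take_take, min_eq_left (by omega)]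
    exact Prod.ext rfl (congrArg f e.symm)

theorem MSeq.coext_step (f : MSeq (σ := σ) k A a →[σ] B) (hf : f (MSeq.root k a) = b)
    {s t : MSeq (σ := σ) k A a} {R : σ.Relations 2} {x : A} (h : t.1 = s.1 ++ [(R, x)]) :
    (t.coext f hf).1 = (s.coext f hf).1 ++ [(R, f t)] := by
  have hs : t.pre s.1.length = s := Subtype.ext (by simp [MSeq.pre, h])
  have hl : t.1.length = s.1.length + 1 := by simp [h]
  have hl' : (t.coext f hf).1.length = s.1.length + 1 := (t.length_coextList f).trans hl
  have h1 : (t.coext f hf).1.take s.1.length = (s.coext f hf).1 := by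
    conv_rhs => rw [← hs, ← MSeq.pre_coext]
    rfl
  have h2 := List.take_succ_eq_append_getElem (l := (t.coext f hf).1) (i := s.1.length) (by omega)
  rw [List.take_of_length_le hl'.le, h1] at h2
  rw [h2]
  congr 2
  have h3 : t.pre (s.1.length + 1) = t := by rw [← hl, t.pre_length]
  simp only [MSeq.coext, MSeq.coextList, List.getElem_ofFn, Fin.getElem_fin, h3]
  simp [h]

theorem MSeq.coext_root (f : MSeq (σ := σ) k A a →[σ] B) (hf : f (MSeq.root k a) = b) :
    (MSeq.root k a).coext f hf = MSeq.root k b :=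
  Subtype.ext (List.length_eq_zero_iff.1 (MSeq.length_coextList f _))

/-- The counit of the modal comonad. -/
def MSeq.counit (k : ℕ) (a : A) : MSeq (σ := σ) k A a →[σ] A where
  toFun := MSeq.last
  map_fun' f := isEmptyElim f
  map_rel' := fun {n} R s h => by
    match n, R, s, h with
    | 1, P, s, h =>
      have e : MSeq.last ∘ s = ![(s 0).last] := by
        funext i
        fin_cases i
        rfl
      rw [e]
      exact h
    | 2, R, s, ⟨x, hx⟩ =>
      have hl : (s 0).1.length < (s 1).1.length := by simp [hx]
      have h := (s 1).2.2 (s 0).1.length hl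
      have e : MSeq.last ∘ s = ![walkLast a ((s 1).1.take (s 0).1.length),
          (s 1).1[(s 0).1.length].2] := by
        funext i
        fin_cases i
        · simp [hx, MSeq.last]
        · simp [hx, MSeq.last, walkLast]
      rw [e]
      have e' : (s 1).1[(s 0).1.length].1 = R := by simp [hx]
      rwa [e'] at h

/-- The coextension of a homomorphism from an unravelling. -/
def MSeq.coextHom (f : MSeq (σ := σ) k A a →[σ] B) (hf : f (MSeq.root k a) = b) :
    MSeq (σ := σ) k A a →[σ] MSeq (σ := σ) k B b where
  toFun := MSeq.coext f hf
  map_fun' g := isEmptyElim g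
  map_rel' := fun {n} R s h => by
    match n, R, s, h with
    | 1, P, s, h =>
      have h' := f.map_rel P s h
      have e : f ∘ s = ![(MSeq.coext f hf (s 0)).last] := by
        funext i
        fin_cases i
        exact (MSeq.last_coext f hf (s 0)).symm
      rw [e] at h'
      exact h'
    | 2, R, s, ⟨x, hx⟩ => exact ⟨f (s 1), MSeq.coext_step f hf hx⟩

theorem MSeq.coext_counit (s : MSeq (σ := σ) k A a) : s.coext (MSeq.counit k a) rfl = s := by
  apply Subtype.ext
  apply List.ext_getElem
  · exact MSeq.length_coextList _ s
  · intro i h1 h2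
    have h := walkLast_take_succ a s.1 i h2
    simp only [MSeq.coext, MSeq.coextList, List.getElem_ofFn]
    exact Prod.ext rfl h

theorem MSeq.coext_coext {D : Type u} [σ.Structure D] {d : D}
    (f : MSeq (σ := σ) k A a →[σ] B) (hf : f (MSeq.root k a) = b)
    (g : MSeq (σ := σ) k B b →[σ] D) (hg : g (MSeq.root k b) = d)
    (hgf : (g.comp (MSeq.coextHom f hf)) (MSeq.root k a) = d) (s : MSeq (σ := σ) k A a) :
    s.coext (g.comp (MSeq.coextHom f hf)) hgf = (s.coext f hf).coext g hg := by
  apply Subtype.ext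
  apply List.ext_getElem
  · exact (MSeq.length_coextList _ s).trans
      ((MSeq.length_coextList _ _).trans (MSeq.length_coextList _ s)).symm
  · intro i h1 h2
    simp only [MSeq.coext, MSeq.coextList, List.getElem_ofFn, Fin.getElem_fin]
    exact Prod.ext rfl (congrArg g (MSeq.pre_coext f hf s (i + 1)).symm)

/-- The modal comonad in Kleisli form. -/
def MKleisli (σ : FirstOrder.Language.{0, 0}) [σ.IsRelational] (k : ℕ) :
    KleisliComonad (PStr.{u} σ) where
  G A := ⟨⟨MSeq (σ := σ) k A.toStr.carrier A.pt⟩, MSeq.root k A.pt⟩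
  ε A := ⟨MSeq.counit k A.pt, rfl⟩
  coext f := ⟨MSeq.coextHom f.1 f.2, MSeq.coext_root f.1 f.2⟩
  coext_counit _ := Subtype.ext (Language.Hom.ext MSeq.coext_counit)
  coext_comp_counit f := Subtype.ext (Language.Hom.ext (MSeq.last_coext f.1 f.2))
  coext_coext f g := Subtype.ext (Language.Hom.ext (MSeq.coext_coext f.1 f.2 g.1 g.2
    ((congrArg g.1 (MSeq.coext_root f.1 f.2)).trans g.2)))

end Modal

/-! ### Eilenberg–Moore categories, paths and pathwise embeddings -/

/-- The comonad `𝔼_k`. -/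
def EFComonad (σ : FirstOrder.Language.{0, 0}) [σ.IsRelational] (k : ℕ) : Comonad (Str.{u} σ) :=
  (EKleisli σ k).toComonad

/-- The comonad `ℙ_k`. -/
def PebComonad (σ : FirstOrder.Language.{0, 0}) [σ.IsRelational] (k : ℕ) : Comonad (Str.{u} σ) :=
  (PKleisli σ k).toComonad

/-- The comonad `𝕄_k`. -/
def ModComonad (σ : FirstOrder.Language.{0, 0}) [σ.IsRelational] (k : ℕ) : Comonad (PStr.{u} σ) :=
  (MKleisli σ k).toComonad

section Paths

variable {σ : FirstOrder.Language.{0, 0}} [σ.IsRelational] {k : ℕ}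

/-- The sequence assigned to an element of an `𝔼_k`-coalgebra by the structure map. -/
def EFComonad.branch (X : (EFComonad.{u} σ k).Coalgebra) (x : X.A.carrier) : List X.A.carrier :=
  (show ESeq k X.A.carrier from (show X.A.carrier →[σ] _ from X.a) x).1

/-- The sequence assigned to an element of a `ℙ_k`-coalgebra by the structure map. -/
def PebComonad.branch (X : (PebComonad.{u} σ k).Coalgebra) (x : X.A.carrier) :
    List (Fin k × X.A.carrier) :=
  ((show X.A.carrier →[σ] PSeq k X.A.carrier from X.a) x).1

/-- The sequence assigned to an element of an `𝕄_k`-coalgebra by the structure map. -/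
def ModComonad.branch (X : (ModComonad.{u} σ k).Coalgebra) (x : X.A.toStr.carrier) :
    List (σ.Relations 2 × X.A.toStr.carrier) :=
  (show MSeq (σ := σ) k X.A.toStr.carrier X.A.pt from X.a.1 x).1

/-- A path in `EM(𝔼_k)`: a coalgebra `α : X → 𝔼_k X` whose forest order
(`x ≤ y` iff `α x` is a prefix of `α y`) is finite and linear. -/
def EFComonad.IsPath (X : (EFComonad.{u} σ k).Coalgebra) : Prop :=
  Finite X.A.carrier ∧
    ∀ x y, EFComonad.branch X x <+: EFComonad.branch X y ∨
      EFComonad.branch X y <+: EFComonad.branch X x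

/-- A path in `EM(ℙ_k)`: a coalgebra `α : X → ℙ_k X` whose forest order
(`x ≤ y` iff `α x` is a prefix of `α y`) is finite and linear. -/
def PebComonad.IsPath (X : (PebComonad.{u} σ k).Coalgebra) : Prop :=
  Finite X.A.carrier ∧
    ∀ x y, PebComonad.branch X x <+: PebComonad.branch X y ∨
      PebComonad.branch X y <+: PebComonad.branch X x

/-- A path in `EM(𝕄_k)`: a coalgebra `α : X → 𝕄_k X` whose tree order
(`x ≤ y` iff `α x` is a prefix of `α y`) is finite and linear. -/
def ModComonad.IsPath (X : (ModComonad.{u} σ k).Coalgebra) : Prop :=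
  Finite X.A.toStr.carrier ∧
    ∀ x y, ModComonad.branch X x <+: ModComonad.branch X y ∨
      ModComonad.branch X y <+: ModComonad.branch X x

/-- `F^I_k(A)` in `EM(𝔼^I_k)`: the co-free coalgebra on `J(A)`. -/
def EFCofreeI (k : ℕ) (A : Str.{u} σ) : (EFComonad.{u} (withI σ) k).Coalgebra :=
  (EFComonad (withI σ) k).cofree.obj (addI A)

/-- `F^I_k(A)` in `EM(ℙ^I_k)`: the co-free coalgebra on `J(A)`. -/
def PebCofreeI (k : ℕ) (A : Str.{u} σ) : (PebComonad.{u} (withI σ) k).Coalgebra :=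
  (PebComonad (withI σ) k).cofree.obj (addI A)

/-- `F_k(A, a)` in `EM(𝕄_k)`: the co-free coalgebra on `(A, a)`. -/
def ModCofree (k : ℕ) (A : PStr.{u} σ) : (ModComonad.{u} σ k).Coalgebra :=
  (ModComonad σ k).cofree.obj A

/-- Pathwise embeddings in `EM(𝔼_k)`. -/
def EFComonad.IsPathwise {X Y : (EFComonad.{u} σ k).Coalgebra} (f : X ⟶ Y) : Prop :=
  IsPathwiseEmbedding (StrEmb σ) EFComonad.IsPath f

/-- Pathwise embeddings in `EM(ℙ_k)`. -/
def PebComonad.IsPathwise {X Y : (PebComonad.{u} σ k).Coalgebra} (f : X ⟶ Y) : Prop :=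
  IsPathwiseEmbedding (StrEmb σ) PebComonad.IsPath f

/-- Pathwise embeddings in `EM(𝕄_k)`. -/
def ModComonad.IsPathwise {X Y : (ModComonad.{u} σ k).Coalgebra} (f : X ⟶ Y) : Prop :=
  IsPathwiseEmbedding (PStrEmb σ) ModComonad.IsPath f

end Paths

/-! ### Existential first-order logic of bounded quantifier rank -/

section FO

variable {σ : FirstOrder.Language.{0, 0}}

/-- The quantifier rank of a first-order formula. -/
def quantifierRank {α : Type} : ∀ {n : ℕ}, σ.BoundedFormula α n → ℕ
  | _, .falsum => 0
  | _, .equal _ _ => 0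
  | _, .rel _ _ => 0
  | _, .imp φ ψ => max (quantifierRank φ) (quantifierRank ψ)
  | _, .all φ => quantifierRank φ + 1

/-- Existential first-order formulas: no universal quantifiers, and negations only applied to
atomic formulas. -/
inductive IsExistentialFO {α : Type} : ∀ {n : ℕ}, σ.BoundedFormula α n → Prop
  | verum {n : ℕ} : IsExistentialFO (⊤ : σ.BoundedFormula α n)
  | falsum {n : ℕ} : IsExistentialFO (⊥ : σ.BoundedFormula α n)
  | atom {n : ℕ} {φ : σ.BoundedFormula α n} (h : φ.IsAtomic) : IsExistentialFO φ
  | neg_atom {n : ℕ} {φ : σ.BoundedFormula α n} (h : φ.IsAtomic) : IsExistentialFO φ.not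
  | and {n : ℕ} {φ ψ : σ.BoundedFormula α n} (hφ : IsExistentialFO φ) (hψ : IsExistentialFO ψ) :
      IsExistentialFO (φ ⊓ ψ)
  | or {n : ℕ} {φ ψ : σ.BoundedFormula α n} (hφ : IsExistentialFO φ) (hψ : IsExistentialFO ψ) :
      IsExistentialFO (φ ⊔ ψ)
  | ex {n : ℕ} {φ : σ.BoundedFormula α (n + 1)} (h : IsExistentialFO φ) : IsExistentialFO φ.ex

/-- The sentences of `∃FO_k`. -/
def existsFO (σ : FirstOrder.Language.{0, 0}) (k : ℕ) : Set σ.Sentence :=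
  {φ | IsExistentialFO φ ∧ quantifierRank φ ≤ k}

/-- Every sentence of `∃FO_k` that is true in `A` is true in `B`. -/
def PreservesExistsFO (k : ℕ) (A B : Str.{u} σ) : Prop :=
  ∀ φ ∈ existsFO σ k, A.carrier ⊨ φ → B.carrier ⊨ φ

end FO

/-! ### Infinitary finite-variable logic -/

section Infinitary

/-- Formulas of infinitary logic that use only the variables `x_i` for `i : Fin k`, and whose free
variables lie in `S`. Conjunctions and disjunctions are indexed by arbitrary types in `Type u`. -/
inductive LFormula (σ : FirstOrder.Language.{0, 0}) (k : ℕ) : Set (Fin k) → Type (u + 1)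
  | equal {S : Set (Fin k)} (i j : S) : LFormula σ k S
  | rel {S : Set (Fin k)} {n : ℕ} (R : σ.Relations n) (x : Fin n → S) : LFormula σ k S
  | neg {S : Set (Fin k)} (φ : LFormula σ k S) : LFormula σ k S
  | conj {S : Set (Fin k)} {ι : Type u} (φ : ι → LFormula σ k S) : LFormula σ k S
  | disj {S : Set (Fin k)} {ι : Type u} (φ : ι → LFormula σ k S) : LFormula σ k S
  | ex {S : Set (Fin k)} (i : Fin k) (φ : LFormula σ k (insert i S)) : LFormula σ k S
  | all {S : Set (Fin k)} (i : Fin k) (φ : LFormula σ k (insert i S)) : LFormula σ k S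

namespace LFormula

variable {σ : FirstOrder.Language.{0, 0}} {k : ℕ}

/-- The assignment that sends `x_i` to `a` and agrees with `v` on the other variables. -/
def assign {A : Type u} {S : Set (Fin k)} (v : S → A) (i : Fin k) (a : A) :
    ↥(insert i S) → A :=
  fun j => if h : j.1 = i then a else v ⟨j.1, j.2.resolve_left h⟩

/-- Satisfaction of a formula under an assignment to its free variables. -/
def Realize {A : Type u} [σ.Structure A] :
    ∀ {S : Set (Fin k)}, LFormula.{u} σ k S → (S → A) → Prop
  | _, equal i j, v => v i = v j
  | _, rel R x, v => Language.Structure.RelMap R (fun i => v (x i))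
  | _, neg φ, v => ¬ φ.Realize v
  | _, conj φ, v => ∀ i, (φ i).Realize v
  | _, disj φ, v => ∃ i, (φ i).Realize v
  | _, ex i φ, v => ∃ a, φ.Realize (assign v i a)
  | _, all i φ, v => ∀ a, φ.Realize (assign v i a)

/-- Existential formulas: no universal quantifiers, and negations only applied to atomic
formulas. -/
inductive IsExistential : ∀ {S : Set (Fin k)}, LFormula.{u} σ k S → Prop
  | equal {S : Set (Fin k)} (i j : S) : IsExistential (.equal i j)
  | rel {S : Set (Fin k)} {n : ℕ} (R : σ.Relations n) (x : Fin n → S) : IsExistential (.rel R x)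
  | neg_equal {S : Set (Fin k)} (i j : S) : IsExistential (.neg (.equal i j))
  | neg_rel {S : Set (Fin k)} {n : ℕ} (R : σ.Relations n) (x : Fin n → S) :
      IsExistential (.neg (.rel R x))
  | conj {S : Set (Fin k)} {ι : Type u} {φ : ι → LFormula.{u} σ k S}
      (h : ∀ i, IsExistential (φ i)) : IsExistential (.conj φ)
  | disj {S : Set (Fin k)} {ι : Type u} {φ : ι → LFormula.{u} σ k S}
      (h : ∀ i, IsExistential (φ i)) : IsExistential (.disj φ)
  | ex {S : Set (Fin k)} (i : Fin k) {φ : LFormula.{u} σ k (insert i S)}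
      (h : IsExistential φ) : IsExistential (.ex i φ)

/-- Truth of a sentence in a structure. -/
def Models (A : Type u) [σ.Structure A] (φ : LFormula.{u} σ k ∅) : Prop :=
  φ.Realize (A := A) (fun i => absurd i.2 (Set.notMem_empty _))

end LFormula

/-- The sentences of `∃𝓛^k`. -/
def existsL (σ : FirstOrder.Language.{0, 0}) (k : ℕ) : Set (LFormula.{u} σ k ∅) :=
  {φ | φ.IsExistential}

/-- Every sentence of `∃𝓛^k` that is true in `A` is true in `B`. -/
def PreservesExistsL {σ : FirstOrder.Language.{0, 0}} (k : ℕ) (A B : Str.{u} σ) : Prop :=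
  ∀ φ ∈ existsL.{u} σ k, φ.Models A.carrier → φ.Models B.carrier

end Infinitary

/-! ### Modal logic -/

section ModalLogic

/-- A modal vocabulary: all symbols have arity at most `2`. -/
def IsModal (σ : FirstOrder.Language.{0, 0}) : Prop :=
  ∀ n, 2 < n → IsEmpty (σ.Relations n)

/-- Modal formulas, with a propositional variable for each unary symbol and modalities `◇_R`, `□_R`
for each binary symbol. -/
inductive ModalFormula (σ : FirstOrder.Language.{0, 0}) : Type
  | var (P : σ.Relations 1) : ModalFormula σ
  | verum : ModalFormula σ
  | falsum : ModalFormula σ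
  | neg (φ : ModalFormula σ) : ModalFormula σ
  | and (φ ψ : ModalFormula σ) : ModalFormula σ
  | or (φ ψ : ModalFormula σ) : ModalFormula σ
  | dia (R : σ.Relations 2) (φ : ModalFormula σ) : ModalFormula σ
  | box (R : σ.Relations 2) (φ : ModalFormula σ) : ModalFormula σ

namespace ModalFormula

variable {σ : FirstOrder.Language.{0, 0}}

/-- The modal depth. -/
def depth : ModalFormula σ → ℕ
  | var _ => 0
  | verum => 0
  | falsum => 0
  | neg φ => φ.depth
  | and φ ψ => max φ.depth ψ.depth
  | or φ ψ => max φ.depth ψ.depth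
  | dia _ φ => φ.depth + 1
  | box _ φ => φ.depth + 1

/-- Kripke semantics. -/
def Sat {A : Type u} [σ.Structure A] : ModalFormula σ → A → Prop
  | var P, a => Language.Structure.RelMap P ![a]
  | verum, _ => True
  | falsum, _ => False
  | neg φ, a => ¬ φ.Sat a
  | and φ ψ, a => φ.Sat a ∧ ψ.Sat a
  | or φ ψ, a => φ.Sat a ∨ ψ.Sat a
  | dia R φ, a => ∃ b : A, Language.Structure.RelMap R ![a, b] ∧ φ.Sat b
  | box R φ, a => ∀ b : A, Language.Structure.RelMap R ![a, b] → φ.Sat b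

/-- Existential modal formulas: no boxes, and negations only applied to propositional variables. -/
inductive IsExistential : ModalFormula σ → Prop
  | var (P : σ.Relations 1) : IsExistential (.var P)
  | neg_var (P : σ.Relations 1) : IsExistential (.neg (.var P))
  | verum : IsExistential .verum
  | falsum : IsExistential .falsum
  | and {φ ψ : ModalFormula σ} (hφ : IsExistential φ) (hψ : IsExistential ψ) :
      IsExistential (.and φ ψ)
  | or {φ ψ : ModalFormula σ} (hφ : IsExistential φ) (hψ : IsExistential ψ) :
      IsExistential (.or φ ψ)
  | dia (R : σ.Relations 2) {φ : ModalFormula σ} (h : IsExistential φ) :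
      IsExistential (.dia R φ)

end ModalFormula

/-- The formulas of `∃ML_k`. -/
def existsML (σ : FirstOrder.Language.{0, 0}) (k : ℕ) : Set (ModalFormula σ) :=
  {φ | φ.IsExistential ∧ φ.depth ≤ k}

/-- Every formula of `∃ML_k` that is true at the point of `A` is true at the point of `B`. -/
def PreservesExistsML {σ : FirstOrder.Language.{0, 0}} (k : ℕ) (A B : PStr.{u} σ) : Prop :=
  ∀ φ ∈ existsML σ k, φ.Sat A.pt → φ.Sat B.pt

end ModalLogic

end GameComonads

open GameComonads

namespace GameComonads

/-! ### Coalgebras of comonads in Kleisli form -/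

section Kleisli

variable {C : Type u} [Category.{v} C] (K : KleisliComonad C)

/-! A pathwise embedding between co-free coalgebras is a winning strategy for Duplicator in an
existential game: Spoiler moves only in A, Duplicator answers in B, and the chosen elements must
satisfy the same atomic formulas (in the modal case, agree on unary symbols while Duplicator copies
the label of each step). Preservation of existential formulas is the existence of such a strategy.

On the side of coalgebras, a morphism into a co-free coalgebra is determined by its composite with
the counit (`KleisliComonad.eq_comp_coext`). A morphism F(A) → F(B) is therefore a coextension of a
function h that answers the last move of each play. The prefixes of a fixed play form a path inside
F(A); testing on these paths shows that for a pathwise embedding h not only preserves but also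
reflects relations on chains of plays. Conversely, a path embedding has a chain as its image, and a
coextension is injective on chains because it preserves length. This gives the three lemmas
`exists_isPathwise_iff`. Injectivity on plays says nothing about equality of the elements chosen;
that is what the symbol I adds: its preservation and reflection make h respect equality in both
directions.

On the side of logic, a strategy transfers formulas by induction: free variables are interpreted by
prefixes of the current play, and a quantifier or diamond extends the play. For the converse, a
finite vocabulary has, at each rank, finitely many existential formulas that suffice to describe the
game (`exists_characteristicFO`, `ModalFormula.exists_characteristic`). In infinitary logic the
invariant is preservation of all existential formulas itself, and a conjunction over all of B shows
that Duplicator always has an answer (`LPreserves.exists_assign`). Finally `exists_unfolding` turns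
answers to single moves into a function on all plays. -/

theorem KleisliComonad.eq_comp_coext {X B : C} (a : X ⟶ K.G X) (m : X ⟶ K.G B)
    (h : a ≫ K.coext (K.ε X ≫ m) = m ≫ K.coext (𝟙 (K.G B))) :
    m = a ≫ K.coext (K.ε X ≫ m ≫ K.ε B) := by
  -- With G for the functor and δ for the comultiplication: G(m ≫ ε) = Gm ≫ Gε, the square `h` turns
  -- a ≫ Gm into m ≫ δ, and δ ≫ Gε is the identity.
  have e : K.coext (K.ε X ≫ m ≫ K.ε B) =
      K.coext (K.ε X ≫ m) ≫ K.coext (K.ε (K.G B) ≫ K.ε B) := by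
    rw [← K.coext_coext, ← Category.assoc (K.coext _), K.coext_comp_counit, Category.assoc]
  rw [e, ← Category.assoc, h, Category.assoc, ← K.coext_coext, ← Category.assoc (K.coext _),
    K.coext_comp_counit, Category.id_comp, K.coext_counit, Category.comp_id]

/-- The previous lemma with a = δ, simplified by the fact that δ followed by the functor applied to
f is the coextension of f. -/
theorem KleisliComonad.eq_coext {A B : C} (m : K.G A ⟶ K.G B)
    (h : K.coext (𝟙 (K.G A)) ≫ K.coext (K.ε (K.G A) ≫ m) = m ≫ K.coext (𝟙 (K.G B))) :
    m = K.coext (m ≫ K.ε B) := by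
  conv_lhs => rw [K.eq_comp_coext _ m h]
  rw [← K.coext_coext, ← Category.assoc, K.coext_comp_counit, Category.id_comp]

/-- The morphism of co-free coalgebras given by a Kleisli morphism. -/
def KleisliComonad.cofreeHom {A B : C} (g : K.G A ⟶ B) :
    K.toComonad.cofree.obj A ⟶ K.toComonad.cofree.obj B where
  f := K.coext g
  h := by
    change K.coext (𝟙 (K.G A)) ≫ K.coext (K.ε (K.G A) ≫ K.coext g) =
      K.coext g ≫ K.coext (𝟙 (K.G B))
    rw [← K.coext_coext, ← K.coext_coext, ← Category.assoc, K.coext_comp_counit]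
    simp

/-- A subobject of a co-free coalgebra that is closed under the comultiplication. -/
def KleisliComonad.subcoalgebra {P A : C} (ι : P ⟶ K.G A) (a : P ⟶ K.G P)
    (h : a ≫ K.coext (K.ε P ≫ ι) = ι ≫ K.coext (𝟙 (K.G A)))
    (h₁ : Mono ι) (h₂ : Mono (K.coext (K.ε (K.G P) ≫ K.coext (K.ε P ≫ ι)))) :
    K.toComonad.Coalgebra where
  A := P
  a := a
  counit := by
    change a ≫ K.ε P = 𝟙 P
    -- After composition with the monomorphism `ι`, naturality of ε and the square `h` reduce the
    -- claim to the counit law of the comonad at A.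
    rw [← cancel_mono ι, Category.assoc, ← K.coext_comp_counit (K.ε P ≫ ι), ← Category.assoc, h,
      Category.assoc, K.coext_comp_counit]
    simp
  coassoc := by
    change a ≫ K.coext (𝟙 (K.G P)) = a ≫ K.coext (K.ε P ≫ a)
    -- This is GGι, monic by `h₂`. After it, naturality of δ (`h3`) and the square `h` (`h4`) leave
    -- the coassociativity of δ at A.
    rw [← cancel_mono (K.coext (K.ε (K.G P) ≫ K.coext (K.ε P ≫ ι)))]
    have h3 : K.coext (𝟙 (K.G P)) ≫ K.coext (K.ε (K.G P) ≫ K.coext (K.ε P ≫ ι)) =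
        K.coext (K.ε P ≫ ι) ≫ K.coext (𝟙 (K.G (K.G A))) := by
      rw [← K.coext_coext, ← K.coext_coext, ← Category.assoc, K.coext_comp_counit]
      simp
    have h4 : K.coext (K.ε P ≫ a) ≫ K.coext (K.ε (K.G P) ≫ K.coext (K.ε P ≫ ι)) =
        K.coext (K.ε P ≫ ι) ≫ K.coext (K.ε (K.G A) ≫ K.coext (𝟙 (K.G A))) := by
      rw [← K.coext_coext, ← K.coext_coext, ← Category.assoc, K.coext_comp_counit,
        ← Category.assoc (K.coext _), K.coext_comp_counit, Category.assoc, h, Category.assoc]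
    rw [Category.assoc, Category.assoc, h3, h4, ← Category.assoc, ← Category.assoc, h,
      Category.assoc, Category.assoc, ← K.coext_coext, ← K.coext_coext,
      ← Category.assoc (K.coext _), K.coext_comp_counit]
    simp

/-- The inclusion of a subcoalgebra of a co-free coalgebra. -/
def KleisliComonad.subcoalgebraHom {P A : C} (ι : P ⟶ K.G A) (a : P ⟶ K.G P)
    (h : a ≫ K.coext (K.ε P ≫ ι) = ι ≫ K.coext (𝟙 (K.G A)))
    (h₁ : Mono ι) (h₂ : Mono (K.coext (K.ε (K.G P) ≫ K.coext (K.ε P ≫ ι)))) :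
    K.subcoalgebra ι a h h₁ h₂ ⟶ K.toComonad.cofree.obj A where
  f := ι
  h := h

end Kleisli

/-! ### Sequences -/

/-- A finite non-empty chain of prefixes has a longest member. The empty tuple is kept as a case
because nullary relation symbols lead to it. -/
theorem exists_common_extension {α : Type*} {n : ℕ} (s : Fin n → List α)
    (h : ∀ i j, s i <+: s j ∨ s j <+: s i) : n = 0 ∨ ∃ j, ∀ i, s i <+: s j := by
  rcases Nat.eq_zero_or_pos n with hn | hn
  · exact Or.inl hn
  · have : Nonempty (Fin n) := ⟨⟨0, hn⟩⟩
    obtain ⟨j, hj⟩ := Finite.exists_max fun i => (s i).length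
    refine Or.inr ⟨j, fun i => (h i j).elim id fun hp => ?_⟩
    rw [hp.eq_of_length_le (hj i)]

/-- A prefix is determined by its length. -/
theorem List.finite_prefixes {α : Type*} (l : List α) : Finite {t : List α // t <+: l} :=
  Finite.of_injective
    (fun t => (⟨t.1.length, Nat.lt_succ_of_le t.2.length_le⟩ : Fin (l.length + 1)))
    fun s t hst => by
      apply Subtype.ext
      rw [List.prefix_iff_eq_take.1 s.2, List.prefix_iff_eq_take.1 t.2]
      have := congrArg Fin.val hst
      simp only at this
      rw [this]

/-- Along the tree of valid sequences, states can be chosen so that successive states are related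
and the invariant holds throughout. -/
theorem exists_unfolding {α : Type*} {β : Type*} {T : Type*} (V : List α → Prop)
    (hV : ∀ l x, V (l ++ [x]) → V l) (Inv : List α → T → Prop) (Step : T → α → β → T → Prop)
    (t₀ : T) (h₀ : Inv [] t₀)
    (hstep : ∀ l x t, V (l ++ [x]) → Inv l t → ∃ y t', Step t x y t' ∧ Inv (l ++ [x]) t') :
    ∃ G : List α → T, G [] = t₀ ∧ (∀ l, V l → Inv l (G l)) ∧
      ∀ l x, V (l ++ [x]) → ∃ y, Step (G l) x y (G (l ++ [x])) := by
  classical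
  -- The fallback value `t` is harmless: along valid sequences the invariant holds, and then `hstep`
  -- supplies a successor.
  let next (l : List α) (x : α) (t : T) : T :=
    if h : ∃ t', ∃ y, Step t x y t' ∧ Inv (l ++ [x]) t' then h.choose else t
  -- Plays grow at the end, so the recursion runs on the reversed list, where a new move is a
  -- `cons`.
  let H : List α → T := fun r =>
    List.rec (motive := fun _ => T) t₀ (fun x r t => next r.reverse x t) r
  have hH : ∀ l x, H ((l ++ [x]).reverse) = next l x (H l.reverse) := fun l x => by
    rw [List.reverse_append]
    change next l.reverse.reverse x (H l.reverse) = _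
    rw [List.reverse_reverse]
  have key : ∀ l x, V (l ++ [x]) → Inv l (H l.reverse) →
      (∃ y, Step (H l.reverse) x y (H ((l ++ [x]).reverse))) ∧
        Inv (l ++ [x]) (H ((l ++ [x]).reverse)) := fun l x hv hi => by
    have h : ∃ t', ∃ y, Step (H l.reverse) x y t' ∧ Inv (l ++ [x]) t' := by
      obtain ⟨y, t', h⟩ := hstep l x _ hv hi
      exact ⟨t', y, h⟩
    have e : H ((l ++ [x]).reverse) = h.choose := by
      rw [hH]
      exact dif_pos h
    rw [e]
    obtain ⟨y, h1, h2⟩ := h.choose_spec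
    exact ⟨⟨y, h1⟩, h2⟩
  have inv : ∀ l, V l → Inv l (H l.reverse) := fun l => by
    induction l using List.reverseRecOn with
    | nil => exact fun _ => h₀
    | append_singleton l x ih => exact fun hv => (key l x hv (ih (hV l x hv))).2
  exact ⟨fun l => H l.reverse, rfl, inv, fun l x hv => (key l x hv (inv l (hV l x hv))).1⟩

/-! ### Pathwise embeddings between co-free coalgebras of the Ehrenfeucht–Fraïssé comonad -/

theorem Str.mono_of_injective {σ : FirstOrder.Language.{0, 0}} {A B : Str.{u} σ} (f : A ⟶ B)
    (hf : Function.Injective (show A.carrier →[σ] B.carrier from f)) : Mono f where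
  right_cancellation {Z} g h e := by
    apply Language.Hom.ext
    intro x
    apply hf
    exact DFunLike.congr_fun (F := Z.carrier →[σ] B.carrier) e x

section EF

variable {σ : FirstOrder.Language.{0, 0}} [σ.IsRelational] {k : ℕ}

/-- The coextension of f after the counit is the action of the functor on f. That this is a
`List.map` shows that the functor preserves injections. -/
theorem ESeq.coext_last_comp {A B : Type u} (f : A → B) (s : ESeq k A) :
    (s.coext fun t => f t.last).1 = s.1.map f := by
  apply List.ext_getElem
  · simp [ESeq.coext]
  · intro i h1 h2
    simp [ESeq.coext, ESeq.last_pre]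

/-! ### The path of prefixes of a sequence, for the Ehrenfeucht–Fraïssé comonad -/

/-- The non-empty prefixes of a list. -/
def ESeq.Below (k : ℕ) {A : Type u} (l : List A) : Type u := {t : ESeq k A // t.1 <+: l}

variable {A : Type u} [σ.Structure A] {l : List A}

instance : σ.Structure (ESeq.Below k l) where
  funMap f := isEmptyElim f
  RelMap R t := Language.Structure.RelMap R (fun i => (t i).1)

/-- The non-empty prefixes of a prefix of a list. -/
def ESeq.Below.branch (t : ESeq.Below k l) : ESeq k (ESeq.Below k l) :=
  ⟨List.ofFn fun i => ⟨t.1.pre i, (List.take_prefix _ _).trans t.2⟩,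
    fun h => t.1.2.1 (List.length_eq_zero_iff.1 (List.ofFn_eq_nil_iff.1 h)),
    List.length_ofFn.trans_le t.1.2.2⟩

/-- `ESeq.coext id` is the comultiplication, which lists the prefixes of a sequence. So `branch` is
the comultiplication restricted to the prefixes of `l`, which is the square required by
`KleisliComonad.subcoalgebra`. -/
theorem ESeq.Below.map_branch (t : ESeq.Below k l) :
    t.branch.1.map Subtype.val = (t.1.coext id).1 :=
  List.map_ofFn

theorem ESeq.Below.last_branch (t : ESeq.Below k l) : t.branch.last = t := by
  apply Subtype.ext
  have h1 : t.branch.last.1 = (t.1.coext id).last := by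
    simp only [ESeq.last, ← ESeq.Below.map_branch]
    exact (List.getLast_map _).symm
  rw [h1, ESeq.last_coext]
  rfl

theorem ESeq.Below.branch_prefix {s t : ESeq.Below k l} (h : s.1.1 <+: t.1.1) :
    s.branch.1 <+: t.branch.1 := by
  have h1 := ESeq.coext_prefix id h
  rw [← ESeq.Below.map_branch, ← ESeq.Below.map_branch] at h1
  exact (List.prefix_map_iff_of_injective Subtype.val_injective).1 h1

/-- The inclusion of the prefixes of a list. -/
def ESeq.Below.incl (l : List A) : ESeq.Below k l →[σ] ESeq k A where
  toFun := Subtype.val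
  map_fun' f := isEmptyElim f
  map_rel' _ _ h := h

/-- The coalgebra structure on the prefixes of a list. -/
def ESeq.Below.branchHom (l : List A) : ESeq.Below k l →[σ] ESeq k (ESeq.Below k l) where
  toFun := ESeq.Below.branch
  map_fun' f := isEmptyElim f
  map_rel' R s h := by
    refine ⟨fun i j => (h.1 i j).imp ESeq.Below.branch_prefix ESeq.Below.branch_prefix, ?_⟩
    simp only [Function.comp_apply, ESeq.Below.last_branch]
    exact h

theorem EKleisli.map_injective {A B : Str.{u} σ} (f : A ⟶ B)
    (hf : Function.Injective (show A.carrier →[σ] B.carrier from f)) :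
    Function.Injective (show ESeq k A.carrier →[σ] ESeq k B.carrier from
      (EKleisli σ k).coext ((EKleisli σ k).ε A ≫ f)) := fun s t h => by
  apply Subtype.ext
  apply List.map_injective_iff.2 hf
  rw [← ESeq.coext_last_comp, ← ESeq.coext_last_comp]
  exact congrArg Subtype.val h

/-- The path of the prefixes of a list in a co-free coalgebra. -/
def EFComonad.path (A : Str.{u} σ) (l : List A.carrier) : (EFComonad.{u} σ k).Coalgebra :=
  (EKleisli σ k).subcoalgebra (P := ⟨ESeq.Below k l⟩) (A := A) (ESeq.Below.incl l)
    (ESeq.Below.branchHom l)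
    (by
      apply Language.Hom.ext
      intro (t : ESeq.Below k l)
      apply Subtype.ext
      exact (ESeq.coext_last_comp _ _).trans t.map_branch)
    (Str.mono_of_injective _ Subtype.val_injective)
    (Str.mono_of_injective _ (EKleisli.map_injective _
      (EKleisli.map_injective _ Subtype.val_injective)))

/-- The inclusion of the path of the prefixes of a list. -/
def EFComonad.pathIncl (A : Str.{u} σ) (l : List A.carrier) :
    EFComonad.path (k := k) A l ⟶ (EFComonad σ k).cofree.obj A :=
  (EKleisli σ k).subcoalgebraHom _ _ _ _ _

theorem EFComonad.isPath_path (A : Str.{u} σ) (l : List A.carrier) :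
    EFComonad.IsPath (EFComonad.path (k := k) A l) := by
  constructor
  · have := List.finite_prefixes l
    exact Finite.of_injective
      (fun t : ESeq.Below k l => (⟨t.1.1, t.2⟩ : {t : List A.carrier // t <+: l}))
      fun s t h => Subtype.ext (Subtype.ext (congrArg (fun x => x.1) h))
  · intro (s : ESeq.Below k l) (t : ESeq.Below k l)
    exact (List.prefix_or_prefix_of_prefix s.2 t.2).imp
      ESeq.Below.branch_prefix ESeq.Below.branch_prefix

/-- Path embeddings see only chains of sequences, and each finite chain lies in the path of prefixes
of one sequence. Being pathwise is therefore a condition on the answers `h` along chains. -/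
theorem EFComonad.exists_isPathwise_iff {A B : Str.{u} σ} :
    (∃ f : (EFComonad σ k).cofree.obj A ⟶ (EFComonad σ k).cofree.obj B,
      EFComonad.IsPathwise f) ↔
    ∃ h : ESeq k A.carrier → B.carrier, ∀ (n : ℕ) (R : σ.Relations n)
      (s : Fin n → ESeq k A.carrier), (∀ i j, (s i).1 <+: (s j).1 ∨ (s j).1 <+: (s i).1) →
        (Language.Structure.RelMap R (fun i => (s i).last) ↔
          Language.Structure.RelMap R (fun i => h (s i))) := by
  constructor
  · rintro ⟨f, hf⟩
    let f' : ESeq k A.carrier →[σ] ESeq k B.carrier := f.f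
    let h : ESeq k A.carrier → B.carrier := fun s => (f' s).last
    have hfh : ∀ s, f' s = s.coext h :=
      DFunLike.congr_fun (F := ESeq k A.carrier →[σ] ESeq k B.carrier)
        ((EKleisli σ k).eq_coext f.f f.h)
    refine ⟨h, fun n R s hs => ⟨fun hR => (f'.map_rel R s ⟨hs, hR⟩).2, fun hR => ?_⟩⟩
    -- For a nullary symbol `l` is empty, and the test path is the empty coalgebra.
    obtain ⟨l, hl⟩ : ∃ l, ∀ i, (s i).1 <+: l := by
      rcases exists_common_extension (fun i => (s i).1) hs with rfl | ⟨j, hj⟩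
      · exact ⟨[], fun i => i.elim0⟩
      · exact ⟨_, hj⟩
    have hm := (hf _ (EFComonad.isPath_path A l) (EFComonad.pathIncl A l)
      ⟨Subtype.val_injective, fun _ _ _ h => h⟩).2 n R fun i => (⟨s i, hl i⟩ : ESeq.Below k l)
    refine (hm ?_).2
    refine ⟨fun i j => ?_, hR⟩
    change (f' (s i)).1 <+: (f' (s j)).1 ∨ (f' (s j)).1 <+: (f' (s i)).1
    rw [hfh, hfh]
    exact (hs i j).imp (ESeq.coext_prefix h) (ESeq.coext_prefix h)
  · rintro ⟨h, hh⟩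
    let g : ESeq k A.carrier →[σ] B.carrier :=
      { toFun := h
        map_fun' := fun f => isEmptyElim f
        map_rel' := fun R s hs => (hh _ R s hs.1).1 hs.2 }
    refine ⟨(EKleisli σ k).cofreeHom g, fun P hP m hm => ?_⟩
    let m' : P.A.carrier →[σ] ESeq k A.carrier := m.f
    -- `m` is the structure map of `P` followed by the coextension of `q`. Coextensions are monotone
    -- for prefixes, so the image of the path `P` is a chain.
    let q : ESeq k P.A.carrier → A.carrier := fun s => (m' s.last).last
    have hmq : ∀ x, m' x = ESeq.coext q ((show P.A.carrier →[σ] ESeq k P.A.carrier from P.a) x) :=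
      DFunLike.congr_fun (F := P.A.carrier →[σ] ESeq k A.carrier)
        ((EKleisli σ k).eq_comp_coext P.a m.f m.h)
    have hc : ∀ x y, (m' x).1 <+: (m' y).1 ∨ (m' y).1 <+: (m' x).1 := fun x y => by
      rw [hmq, hmq]
      exact (hP.2 x y).imp (ESeq.coext_prefix q) (ESeq.coext_prefix q)
    refine ⟨fun x y hxy => hm.1 ?_, fun n R x hR => hm.2 n R x ?_⟩
    · change (m' x).coext h = (m' y).coext h at hxy
      -- Coextension keeps lengths, and comparable sequences of equal length coincide; injectivity
      -- asks nothing of `h`.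
      have hl : (m' x).1.length = (m' y).1.length := by
        simpa [ESeq.coext] using congrArg (fun s => s.1.length) hxy
      exact Subtype.ext ((hc x y).elim (fun hp => hp.eq_of_length hl)
        fun hp => (hp.eq_of_length hl.symm).symm)
    · change Language.Structure.RelMap R (fun i => (m' (x i)).coext h) at hR
      have h1 := hR.2
      simp only [ESeq.last_coext] at h1
      exact ⟨fun i j => hc _ _, (hh n R _ fun i j => hc _ _).2 h1⟩

end EF

/-! ### Pathwise embeddings between co-free coalgebras of the pebbling comonad -/

section Pebbling

variable {σ : FirstOrder.Language.{0, 0}} [σ.IsRelational] {k : ℕ}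

theorem PSeq.coext_last_comp {A B : Type u} (f : A → B) (s : PSeq k A) :
    (s.coext fun t => f t.last).1 = s.1.map (Prod.map id f) := by
  apply List.ext_getElem
  · simp [PSeq.coext]
  · intro i h1 h2
    simp [PSeq.coext, PSeq.last, PSeq.lastMove_pre, Prod.map]

theorem PSeq.last_coext {A B : Type u} (f : PSeq k A → B) (s : PSeq k A) :
    (s.coext f).last = f s := congrArg Prod.snd (PSeq.lastMove_coext f s)

theorem PSeq.pebble_coext {A B : Type u} (f : PSeq k A → B) (s : PSeq k A) :
    (s.coext f).pebble = s.pebble := congrArg Prod.fst (PSeq.lastMove_coext f s)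

/-- Sequences that are pairwise comparable, and such that no pebble of a last move is moved again
in another of the sequences. -/
def PSeq.Active {A : Type u} {n : ℕ} (s : Fin n → PSeq k A) : Prop :=
  (∀ i j, (s i).1 <+: (s j).1 ∨ (s j).1 <+: (s i).1) ∧
    ∀ i j, ∀ w, (s i).1 ++ w = (s j).1 → (s i).pebble ∉ w.map Prod.fst

theorem PSeq.relMap_iff {A : Type u} [σ.Structure A] {n : ℕ} (R : σ.Relations n)
    (s : Fin n → PSeq k A) : Language.Structure.RelMap R s ↔
      Active s ∧ Language.Structure.RelMap R (fun i => (s i).last) :=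
  ⟨fun h => ⟨⟨h.1, h.2.2⟩, h.2.1⟩, fun h => ⟨h.1.1, h.2, h.1.2⟩⟩

/-- Coextension changes the elements but neither the pebbles nor the lengths, so the suffixes
involved carry the same pebble indices. Comparability has to be assumed, since a coextension may
make incomparable sequences comparable. -/
theorem PSeq.active_coext_iff {A B : Type u} (f : PSeq k A → B) {n : ℕ} (s : Fin n → PSeq k A)
    (hc : ∀ i j, (s i).1 <+: (s j).1 ∨ (s j).1 <+: (s i).1) :
    Active (fun i => (s i).coext f) ↔ Active s := by
  have aux : ∀ i j, (∀ w, (s i).1 ++ w = (s j).1 → (s i).pebble ∉ w.map Prod.fst) ↔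
      ∀ w, ((s i).coext f).1 ++ w = ((s j).coext f).1 →
        ((s i).coext f).pebble ∉ w.map Prod.fst := by
    intro i j
    rcases hc i j with hp | hp
    · obtain ⟨z, hz⟩ := hp
      obtain ⟨z', hz'⟩ := PSeq.coext_prefix f ⟨z, hz⟩
      have e := congrArg (List.map Prod.fst) hz'
      rw [List.map_append, PSeq.map_fst_coext, PSeq.map_fst_coext, ← hz, List.map_append,
        List.append_cancel_left_eq] at e
      simp only [← hz, ← hz', List.append_cancel_left_eq, forall_eq, pebble_coext, e]
    -- Here `s j` is the shorter sequence, so the suffix `w` is empty and both conditions are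
    -- trivial.
    · have h1 := hp.length_le
      have h2 := (PSeq.coext_prefix f hp).length_le
      constructor
      all_goals
        intro _ w hw
        have h3 := congrArg List.length hw
        rw [List.length_append] at h3
        have h4 : w = [] := List.length_eq_zero_iff.1 (by omega)
        simp [h4]
  simp only [Active, aux]
  exact and_congr_left fun _ => iff_of_true
    (fun i j => (hc i j).imp (PSeq.coext_prefix f) (PSeq.coext_prefix f)) hc

/-! ### The path of prefixes of a sequence, for the pebbling comonad -/

/-- The non-empty prefixes of a list. -/
def PSeq.Below (k : ℕ) {A : Type u} (l : List (Fin k × A)) : Type u := {t : PSeq k A // t.1 <+: l}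

variable {A : Type u} [σ.Structure A] {l : List (Fin k × A)}

instance : σ.Structure (PSeq.Below k l) where
  funMap f := isEmptyElim f
  RelMap R t := Language.Structure.RelMap R (fun i => (t i).1)

/-- The non-empty prefixes of a prefix of a list. -/
def PSeq.Below.branch (t : PSeq.Below k l) : PSeq k (PSeq.Below k l) :=
  ⟨List.ofFn fun i => (t.1.1[i].1, ⟨t.1.pre i, (List.take_prefix _ _).trans t.2⟩),
    fun h => t.1.2 (List.length_eq_zero_iff.1 (List.ofFn_eq_nil_iff.1 h))⟩

theorem PSeq.Below.val_prod_injective :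
    Function.Injective (Prod.map id Subtype.val : Fin k × PSeq.Below k l → Fin k × PSeq k A) :=
  Function.injective_id.prodMap Subtype.val_injective

theorem PSeq.Below.map_branch (t : PSeq.Below k l) :
    t.branch.1.map (Prod.map id Subtype.val) = (t.1.coext id).1 :=
  List.map_ofFn

theorem PSeq.Below.last_branch (t : PSeq.Below k l) : t.branch.last = t := by
  apply Subtype.ext
  have h1 : t.branch.last.1 = (t.1.coext id).last := by
    simp only [PSeq.last, PSeq.lastMove, ← PSeq.Below.map_branch]
    exact congrArg Prod.snd (List.getLast_map (f := Prod.map id Subtype.val) _).symm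
  rw [h1, PSeq.last_coext]
  rfl

theorem PSeq.Below.pebble_branch (t : PSeq.Below k l) : t.branch.pebble = t.1.pebble := by
  have h1 : t.branch.pebble = (t.1.coext id).pebble := by
    simp only [PSeq.pebble, PSeq.lastMove, ← PSeq.Below.map_branch]
    exact congrArg Prod.fst
      (List.getLast_map (l := t.branch.1) (f := Prod.map id Subtype.val) _).symm
  rw [h1, PSeq.pebble_coext]

theorem PSeq.Below.branch_prefix {s t : PSeq.Below k l} (h : s.1.1 <+: t.1.1) :
    s.branch.1 <+: t.branch.1 := by
  have h1 := PSeq.coext_prefix id h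
  rw [← PSeq.Below.map_branch, ← PSeq.Below.map_branch] at h1
  exact (List.prefix_map_iff_of_injective PSeq.Below.val_prod_injective).1 h1

/-- The inclusion of the prefixes of a list. -/
def PSeq.Below.incl (l : List (Fin k × A)) : PSeq.Below k l →[σ] PSeq k A where
  toFun := Subtype.val
  map_fun' f := isEmptyElim f
  map_rel' _ _ h := h

/-- The coalgebra structure on the prefixes of a list. -/
def PSeq.Below.branchHom (l : List (Fin k × A)) : PSeq.Below k l →[σ] PSeq k (PSeq.Below k l) where
  toFun := PSeq.Below.branch
  map_fun' f := isEmptyElim f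
  map_rel' R s h := by
    have h1 : Active fun i => (s i).1 := ((PSeq.relMap_iff R _).1 h).1
    refine (PSeq.relMap_iff R _).2 ⟨?_, ?_⟩
    -- The comultiplication preserves the pebble condition. It descends to `branch` because
    -- forgetting the bound on prefixes is injective and keeps pebble indices.
    · have h2 : Active fun i => (s i).1.coext id := (PSeq.active_coext_iff id _ h1.1).2 h1
      refine ⟨fun i j => (h1.1 i j).imp PSeq.Below.branch_prefix PSeq.Below.branch_prefix, ?_⟩
      intro i j w hw
      have h3 := h2.2 i j (w.map (Prod.map id Subtype.val))
      rw [← PSeq.Below.map_branch, ← PSeq.Below.map_branch] at h3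
      have h4 := h3 (List.map_append.symm.trans
        (congrArg (List.map (Prod.map id Subtype.val)) hw))
      rw [PSeq.pebble_coext] at h4
      rw [Function.comp_apply, PSeq.Below.pebble_branch]
      exact fun h5 => h4 (Eq.mpr (congrArg (_ ∈ ·) List.map_map) h5)
    · simp only [Function.comp_apply, PSeq.Below.last_branch]
      exact h

theorem PKleisli.map_injective {A B : Str.{u} σ} (f : A ⟶ B)
    (hf : Function.Injective (show A.carrier →[σ] B.carrier from f)) :
    Function.Injective (show PSeq k A.carrier →[σ] PSeq k B.carrier from
      (PKleisli σ k).coext ((PKleisli σ k).ε A ≫ f)) := fun s t h => by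
  apply Subtype.ext
  apply List.map_injective_iff.2 (Function.injective_id.prodMap hf)
  rw [← PSeq.coext_last_comp, ← PSeq.coext_last_comp]
  exact congrArg Subtype.val h

/-- The path of the prefixes of a list in a co-free coalgebra. -/
def PebComonad.path (A : Str.{u} σ) (l : List (Fin k × A.carrier)) :
    (PebComonad.{u} σ k).Coalgebra :=
  (PKleisli σ k).subcoalgebra (P := ⟨PSeq.Below k l⟩) (A := A) (PSeq.Below.incl l)
    (PSeq.Below.branchHom l)
    (by
      apply Language.Hom.ext
      intro (t : PSeq.Below k l)
      apply Subtype.ext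
      exact (PSeq.coext_last_comp _ _).trans t.map_branch)
    (Str.mono_of_injective _ Subtype.val_injective)
    (Str.mono_of_injective _ (PKleisli.map_injective _
      (PKleisli.map_injective _ Subtype.val_injective)))

/-- The inclusion of the path of the prefixes of a list. -/
def PebComonad.pathIncl (A : Str.{u} σ) (l : List (Fin k × A.carrier)) :
    PebComonad.path (k := k) A l ⟶ (PebComonad σ k).cofree.obj A :=
  (PKleisli σ k).subcoalgebraHom _ _ _ _ _

theorem PebComonad.isPath_path (A : Str.{u} σ) (l : List (Fin k × A.carrier)) :
    PebComonad.IsPath (PebComonad.path (k := k) A l) := by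
  constructor
  · have := List.finite_prefixes l
    exact Finite.of_injective
      (fun t : PSeq.Below k l => (⟨t.1.1, t.2⟩ : {t : List (Fin k × A.carrier) // t <+: l}))
      fun s t h => Subtype.ext (Subtype.ext (congrArg (fun x => x.1) h))
  · intro (s : PSeq.Below k l) (t : PSeq.Below k l)
    exact (List.prefix_or_prefix_of_prefix s.2 t.2).imp
      PSeq.Below.branch_prefix PSeq.Below.branch_prefix

/-- The argument is that of the Ehrenfeucht–Fraïssé comonad. The pebble condition is the same for a
chain and its coextension, so it becomes a side condition on tuples rather than a demand on `h`. -/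
theorem PebComonad.exists_isPathwise_iff {A B : Str.{u} σ} :
    (∃ f : (PebComonad σ k).cofree.obj A ⟶ (PebComonad σ k).cofree.obj B,
      PebComonad.IsPathwise f) ↔
    ∃ h : PSeq k A.carrier → B.carrier, ∀ (n : ℕ) (R : σ.Relations n)
      (s : Fin n → PSeq k A.carrier), PSeq.Active s →
        (Language.Structure.RelMap R (fun i => (s i).last) ↔
          Language.Structure.RelMap R (fun i => h (s i))) := by
  constructor
  · rintro ⟨f, hf⟩
    let f' : PSeq k A.carrier →[σ] PSeq k B.carrier := f.f
    let h : PSeq k A.carrier → B.carrier := fun s => (f' s).last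
    have hfh : ∀ s, f' s = s.coext h :=
      DFunLike.congr_fun (F := PSeq k A.carrier →[σ] PSeq k B.carrier)
        ((PKleisli σ k).eq_coext f.f f.h)
    refine ⟨h, fun n R s hs => ⟨fun hR =>
      ((PSeq.relMap_iff R _).1 (f'.map_rel R s ((PSeq.relMap_iff R s).2 ⟨hs, hR⟩))).2,
      fun hR => ?_⟩⟩
    obtain ⟨l, hl⟩ : ∃ l, ∀ i, (s i).1 <+: l := by
      rcases exists_common_extension (fun i => (s i).1) hs.1 with rfl | ⟨j, hj⟩
      · exact ⟨[], fun i => i.elim0⟩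
      · exact ⟨_, hj⟩
    have hm := (hf _ (PebComonad.isPath_path A l) (PebComonad.pathIncl A l)
      ⟨Subtype.val_injective, fun _ _ _ h => h⟩).2 n R fun i => (⟨s i, hl i⟩ : PSeq.Below k l)
    refine ((PSeq.relMap_iff R s).1 (hm ?_)).2
    change Language.Structure.RelMap R fun i => f' (s i)
    refine (PSeq.relMap_iff R _).2 ⟨?_, hR⟩
    simp only [hfh]
    exact (PSeq.active_coext_iff h s hs.1).2 hs
  · rintro ⟨h, hh⟩
    let g : PSeq k A.carrier →[σ] B.carrier :=
      { toFun := h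
        map_fun' := fun f => isEmptyElim f
        map_rel' := fun R s hs => (hh _ R s ((PSeq.relMap_iff R s).1 hs).1).1 hs.2.1 }
    refine ⟨(PKleisli σ k).cofreeHom g, fun P hP m hm => ?_⟩
    let m' : P.A.carrier →[σ] PSeq k A.carrier := m.f
    let q : PSeq k P.A.carrier → A.carrier := fun s => (m' s.last).last
    have hmq : ∀ x, m' x = PSeq.coext q ((show P.A.carrier →[σ] PSeq k P.A.carrier from P.a) x) :=
      DFunLike.congr_fun (F := P.A.carrier →[σ] PSeq k A.carrier)
        ((PKleisli σ k).eq_comp_coext P.a m.f m.h)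
    have hc : ∀ x y, (m' x).1 <+: (m' y).1 ∨ (m' y).1 <+: (m' x).1 := fun x y => by
      rw [hmq, hmq]
      exact (hP.2 x y).imp (PSeq.coext_prefix q) (PSeq.coext_prefix q)
    refine ⟨fun x y hxy => hm.1 ?_, fun n R x hR => hm.2 n R x ?_⟩
    · change (m' x).coext h = (m' y).coext h at hxy
      have hl : (m' x).1.length = (m' y).1.length := by
        simpa [PSeq.coext] using congrArg (fun s => s.1.length) hxy
      exact Subtype.ext ((hc x y).elim (fun hp => hp.eq_of_length hl)
        fun hp => (hp.eq_of_length hl.symm).symm)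
    · change Language.Structure.RelMap R (fun i => (m' (x i)).coext h) at hR
      obtain ⟨h1, h2⟩ := (PSeq.relMap_iff R _).1 hR
      simp only [PSeq.last_coext] at h2
      have h3 := (PSeq.active_coext_iff h _ fun i j => hc (x i) (x j)).1 h1
      exact (PSeq.relMap_iff R _).2 ⟨h3, (hh n R _ h3).2 h2⟩

end Pebbling

/-! ### Pathwise embeddings between co-free coalgebras of the modal comonad -/

theorem PStr.mono_of_injective {σ : FirstOrder.Language.{0, 0}} {A B : PStr.{u} σ} (f : A ⟶ B)
    (hf : Function.Injective f.1) : Mono f where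
  right_cancellation {Z} g h e := by
    apply Subtype.ext
    apply Language.Hom.ext
    intro x
    apply hf
    exact DFunLike.congr_fun (F := Z.toStr.carrier →[σ] B.toStr.carrier) (congrArg Subtype.val e) x

section Modal

variable {σ : FirstOrder.Language.{0, 0}} [σ.IsRelational] {k : ℕ}
  {A B : Type u} [σ.Structure A] [σ.Structure B] {a : A} {b : B}

theorem MSeq.coext_prefix (f : MSeq (σ := σ) k A a →[σ] B) (hf : f (MSeq.root k a) = b)
    {s t : MSeq (σ := σ) k A a} (h : s.1 <+: t.1) : (s.coext f hf).1 <+: (t.coext f hf).1 := by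
  have e : s = t.pre s.1.length := Subtype.ext (List.prefix_iff_eq_take.1 h)
  rw [e, ← MSeq.pre_coext]
  exact List.take_prefix _ _

theorem MSeq.length_coext (f : MSeq (σ := σ) k A a →[σ] B) (hf : f (MSeq.root k a) = b)
    (s : MSeq (σ := σ) k A a) : (s.coext f hf).1.length = s.1.length :=
  MSeq.length_coextList f s

/-- The left side is the action of the functor on `f`; in this form it is visibly injective when `f`
is. -/
theorem MSeq.coext_counit_comp (f : A →[σ] B) (hf : f a = b)
    (s : MSeq (σ := σ) k A a) :
    (s.coext (f.comp (MSeq.counit k a)) hf).1 = s.1.map (Prod.map id f) := by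
  apply List.ext_getElem
  · rw [List.length_map]
    exact MSeq.length_coextList _ s
  · intro i h1 h2
    replace h1 := h1.trans_eq (MSeq.length_coextList _ s)
    have h := walkLast_take_succ a s.1 i h1
    simp only [MSeq.coext, MSeq.coextList, List.getElem_ofFn, List.getElem_map]
    exact Prod.ext rfl (congrArg f h)

/-! ### The path of initial segments, for the modal comonad -/

/-- The initial segments of a path. -/
def MSeq.Below (s : MSeq (σ := σ) k A a) : Type u := {t : MSeq (σ := σ) k A a // t.1 <+: s.1}

variable {s : MSeq (σ := σ) k A a}

instance : σ.Structure s.Below where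
  funMap f := isEmptyElim f
  RelMap R t := Language.Structure.RelMap R (fun i => (t i).1)

/-- The trivial path, as an initial segment. -/
def MSeq.Below.root (s : MSeq (σ := σ) k A a) : s.Below := ⟨MSeq.root k a, List.nil_prefix⟩

/-- The initial segment of length `min i t.length` of an initial segment. -/
def MSeq.Below.pre (t : s.Below) (i : ℕ) : s.Below :=
  ⟨t.1.pre i, (List.take_prefix _ _).trans t.2⟩

theorem MSeq.Below.relMap_pre (t : s.Below) (j : ℕ) (hj : j < t.1.1.length) :
    Language.Structure.RelMap t.1.1[j].1 ![t.pre j, t.pre (j + 1)] :=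
  ⟨t.1.1[j].2, List.take_succ_eq_append_getElem hj⟩

/-- The list of the nontrivial initial segments of an initial segment. -/
def MSeq.Below.branchList (t : s.Below) : List (σ.Relations 2 × s.Below) :=
  List.ofFn fun i : Fin t.1.1.length => (t.1.1[i].1, t.pre (i + 1))

set_option linter.unusedSectionVars false in
theorem MSeq.Below.length_branchList (t : s.Below) : t.branchList.length = t.1.1.length :=
  List.length_ofFn

theorem MSeq.Below.walkLast_take_branchList (t : s.Below) (j : ℕ) (hj : j ≤ t.1.1.length) :
    walkLast (MSeq.Below.root s) (t.branchList.take j) = t.pre j := by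
  cases j with
  | zero => exact Subtype.ext (Subtype.ext (List.take_zero (l := t.1.1)).symm)
  | succ j =>
    rw [walkLast_take_succ _ _ _ (by rw [length_branchList]; omega)]
    exact congrArg Prod.snd (List.getElem_ofFn _)

/-- The path of the initial segments of an initial segment. -/
def MSeq.Below.branch (t : s.Below) : MSeq (σ := σ) k s.Below (MSeq.Below.root s) :=
  ⟨t.branchList, t.length_branchList.trans_le t.1.2.1, fun j hj => by
    have hj' := hj.trans_eq t.length_branchList
    rw [walkLast_take_branchList _ _ hj'.le]
    have e : t.branchList[j] = (t.1.1[j].1, t.pre (j + 1)) := List.getElem_ofFn _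
    rw [e]
    exact t.relMap_pre j hj'⟩

theorem MSeq.Below.last_branch (t : s.Below) : t.branch.last = t := by
  have h := t.walkLast_take_branchList _ le_rfl
  rw [List.take_of_length_le t.length_branchList.le] at h
  exact h.trans (Subtype.ext t.1.pre_length)

theorem MSeq.Below.branch_step {t t' : s.Below} {R : σ.Relations 2} {x : A}
    (h : t'.1.1 = t.1.1 ++ [(R, x)]) : t'.branch.1 = t.branch.1 ++ [(R, t')] := by
  have hl : t'.1.1.length = t.1.1.length + 1 := by simp [h]
  apply List.ext_getElem
  · rw [List.length_append]
    exact t'.length_branchList.trans (hl.trans (congrArg (· + 1) t.length_branchList.symm))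
  · intro i h1 h2
    have h1' : i < t'.1.1.length := h1.trans_eq t'.length_branchList
    have e : t'.branch.1[i] = (t'.1.1[i].1, t'.pre (i + 1)) := List.getElem_ofFn _
    rw [e, List.getElem_append]
    split
    · next h3 =>
      have h3' : i < t.1.1.length := h3.trans_eq t.length_branchList
      have e' : t.branch.1[i] = (t.1.1[i].1, t.pre (i + 1)) := List.getElem_ofFn _
      rw [e']
      refine Prod.ext ?_ (Subtype.ext (Subtype.ext ?_))
      · simp [h, h3']
      · change t'.1.1.take (i + 1) = t.1.1.take (i + 1)
        rw [h, List.take_append_of_le_length h3']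
    · next h3 =>
      have h3' : i = t.1.1.length := by
        have : ¬ i < t.1.1.length := fun h4 => h3 (h4.trans_eq t.length_branchList.symm)
        omega
      subst h3'
      have : t'.pre (t.1.1.length + 1) = t' :=
        Subtype.ext (Subtype.ext (List.take_of_length_le hl.le))
      simp [h, this]

theorem MSeq.Below.branch_prefix {t t' : s.Below} (h : t.1.1 <+: t'.1.1) :
    t.branch.1 <+: t'.branch.1 := by
  rw [List.prefix_iff_eq_take]
  apply List.ext_getElem
  · rw [List.length_take]
    exact (t.length_branchList).trans ((min_eq_left h.length_le).symm.trans
      (congrArg₂ min t.length_branchList.symm t'.length_branchList.symm))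
  · intro i h1 h2
    have h1' : i < t.1.1.length := h1.trans_eq t.length_branchList
    have e : t.branch.1[i] = (t.1.1[i].1, t.pre (i + 1)) := List.getElem_ofFn _
    have e' : t'.branch.1[i]'(h1'.trans_le (h.length_le.trans_eq t'.length_branchList.symm)) =
        ((t'.1.1[i]'(h1'.trans_le h.length_le)).1, t'.pre (i + 1)) := List.getElem_ofFn _
    rw [e, List.getElem_take, h.getElem h1']
    refine Eq.trans ?_ e'.symm
    refine Prod.ext rfl (Subtype.ext (Subtype.ext ?_))
    obtain ⟨w, hw⟩ := h
    change t.1.1.take (i + 1) = t'.1.1.take (i + 1)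
    rw [← hw, List.take_append_of_le_length h1']

/-- The inclusion of the initial segments of a path. -/
def MSeq.Below.incl (s : MSeq (σ := σ) k A a) : s.Below →[σ] MSeq (σ := σ) k A a where
  toFun := Subtype.val
  map_fun' f := isEmptyElim f
  map_rel' _ _ h := h

/-- The coalgebra structure on the initial segments of a path. -/
def MSeq.Below.branchHom (s : MSeq (σ := σ) k A a) :
    s.Below →[σ] MSeq (σ := σ) k s.Below (MSeq.Below.root s) where
  toFun := MSeq.Below.branch
  map_fun' f := isEmptyElim f
  map_rel' := fun {n} R t h => by
    match n, R, t, h with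
    | 1, P, t, h =>
      have e : ![(t 0).branch.last] = t := by
        funext i
        fin_cases i
        exact (t 0).last_branch
      change Language.Structure.RelMap P ![(t 0).branch.last]
      rw [e]
      exact h
    | 2, R, t, ⟨x, hx⟩ => exact ⟨_, MSeq.Below.branch_step hx⟩

theorem MKleisli.map_injective {A B : PStr.{u} σ} (f : A ⟶ B) (hf : Function.Injective f.1) :
    Function.Injective ((MKleisli σ k).coext ((MKleisli σ k).ε A ≫ f)).1 :=
    fun (s t : MSeq k A.toStr.carrier A.pt) h => by
  apply Subtype.ext
  apply List.map_injective_iff.2 (Function.injective_id.prodMap hf)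
  rw [← MSeq.coext_counit_comp f.1 f.2, ← MSeq.coext_counit_comp f.1 f.2]
  exact congrArg Subtype.val h

/-- The path of the initial segments of an element of a co-free coalgebra. -/
def ModComonad.path (A : PStr.{u} σ) (s : MSeq (σ := σ) k A.toStr.carrier A.pt) :
    (ModComonad.{u} σ k).Coalgebra :=
  (MKleisli σ k).subcoalgebra (P := ⟨⟨s.Below⟩, MSeq.Below.root s⟩) (A := A)
    ⟨MSeq.Below.incl s, rfl⟩ ⟨MSeq.Below.branchHom s, rfl⟩
    (by
      apply Subtype.ext
      apply Language.Hom.ext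
      intro (t : s.Below)
      apply Subtype.ext
      refine (MSeq.coext_counit_comp (MSeq.Below.incl s) rfl t.branch).trans ?_
      exact List.map_ofFn)
    (PStr.mono_of_injective _ Subtype.val_injective)
    (PStr.mono_of_injective _ (MKleisli.map_injective _
      (MKleisli.map_injective _ Subtype.val_injective)))

/-- The inclusion of the path of the initial segments of an element. -/
def ModComonad.pathIncl (A : PStr.{u} σ) (s : MSeq (σ := σ) k A.toStr.carrier A.pt) :
    ModComonad.path A s ⟶ (ModComonad σ k).cofree.obj A :=
  (MKleisli σ k).subcoalgebraHom _ _ _ _ _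

theorem ModComonad.isPath_path (A : PStr.{u} σ) (s : MSeq (σ := σ) k A.toStr.carrier A.pt) :
    ModComonad.IsPath (ModComonad.path A s) := by
  constructor
  · have := List.finite_prefixes s.1
    exact Finite.of_injective
      (fun t : s.Below =>
        (⟨t.1.1, t.2⟩ : {t : List (σ.Relations 2 × A.toStr.carrier) // t <+: s.1}))
      fun s t h => Subtype.ext (Subtype.ext (congrArg (fun x => x.1) h))
  · intro (t : s.Below) (t' : s.Below)
    exact (List.prefix_or_prefix_of_prefix t.2 t'.2).imp
      MSeq.Below.branch_prefix MSeq.Below.branch_prefix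

/-- Only unary symbols need to be reflected by `h`. In an unravelling a binary symbol is determined
by the lengths and labels along a chain, both kept by coextension, and symbols of arity other than 1
and 2 hold of nothing. -/
theorem ModComonad.exists_isPathwise_iff {A B : PStr.{u} σ} :
    (∃ f : (ModComonad σ k).cofree.obj A ⟶ (ModComonad σ k).cofree.obj B,
      ModComonad.IsPathwise f) ↔
    ∃ h : MSeq (σ := σ) k A.toStr.carrier A.pt → B.toStr.carrier, h (MSeq.root k A.pt) = B.pt ∧
      (∀ (P : σ.Relations 1) s, Language.Structure.RelMap P ![s.last] ↔
        Language.Structure.RelMap P ![h s]) ∧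
      ∀ (R : σ.Relations 2) (x : A.toStr.carrier) s t, t.1 = s.1 ++ [(R, x)] →
        Language.Structure.RelMap R ![h s, h t] := by
  constructor
  · rintro ⟨f, hf⟩
    let f' : MSeq (σ := σ) k A.toStr.carrier A.pt →[σ] MSeq (σ := σ) k B.toStr.carrier B.pt := f.f.1
    refine ⟨fun s => (f' s).last, congrArg MSeq.last f.f.2, fun P s => ⟨fun h => ?_, fun h => ?_⟩,
      fun R x s t h => ?_⟩
    · exact f'.map_rel P ![s] h
    · exact (hf _ (ModComonad.isPath_path A s) (ModComonad.pathIncl A s)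
        ⟨Subtype.val_injective, fun _ _ _ h => h⟩).2 1 P
          ![(⟨s, List.prefix_rfl⟩ : s.Below)] h
    · have h1 := ((MSeq.counit k B.pt).comp f').map_rel R ![s, t] ⟨x, h⟩
      have e : ((MSeq.counit k B.pt).comp f') ∘ ![s, t] = ![(f' s).last, (f' t).last] := by
        funext i
        fin_cases i <;> rfl
      rwa [e] at h1
  · rintro ⟨h, h0, h1, h2⟩
    let g : MSeq (σ := σ) k A.toStr.carrier A.pt →[σ] B.toStr.carrier :=
      { toFun := h
        map_fun' := fun f => isEmptyElim f
        map_rel' := fun {n} R s hs => by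
          match n, R, s, hs with
          | 1, P, s, hs =>
            have e : h ∘ s = ![h (s 0)] := by
              funext i
              fin_cases i
              rfl
            rw [e]
            exact (h1 P (s 0)).1 hs
          | 2, R, s, ⟨x, hx⟩ =>
            have e : h ∘ s = ![h (s 0), h (s 1)] := by
              funext i
              fin_cases i <;> rfl
            rw [e]
            exact h2 R x _ _ hx }
    refine ⟨(MKleisli σ k).cofreeHom ⟨g, h0⟩, fun P hP m hm => ?_⟩
    let m' : P.A.toStr.carrier →[σ] MSeq (σ := σ) k A.toStr.carrier A.pt := m.f.1
    let q := (MKleisli σ k).ε P.A ≫ m.f ≫ (MKleisli σ k).ε A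
    have hmq : ∀ x, m' x = MSeq.coext q.1 q.2 (P.a.1 x) :=
      DFunLike.congr_fun (F := P.A.toStr.carrier →[σ] MSeq (σ := σ) k A.toStr.carrier A.pt)
        (congrArg Subtype.val ((MKleisli σ k).eq_comp_coext P.a m.f m.h))
    have hc : ∀ x y, (m' x).1 <+: (m' y).1 ∨ (m' y).1 <+: (m' x).1 := fun x y => by
      rw [hmq, hmq]
      exact (hP.2 x y).imp (MSeq.coext_prefix q.1 q.2) (MSeq.coext_prefix q.1 q.2)
    refine ⟨fun x y hxy => hm.1 ?_, fun n R x hR => hm.2 n R x ?_⟩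
    · change (m' x).coext g h0 = (m' y).coext g h0 at hxy
      have hl : (m' x).1.length = (m' y).1.length := by
        simpa [MSeq.length_coext] using congrArg (fun s => s.1.length) hxy
      exact Subtype.ext ((hc x y).elim (fun hp => hp.eq_of_length hl)
        fun hp => (hp.eq_of_length hl.symm).symm)
    · change Language.Structure.RelMap R (fun i => (m' (x i)).coext g h0) at hR
      change Language.Structure.RelMap R (fun i => m' (x i))
      match n, R, x, hR with
      | 1, P, x, hR =>
        refine (h1 P _).2 ?_
        change Language.Structure.RelMap P ![((m' (x 0)).coext g h0).last] at hR
        rwa [MSeq.last_coext] at hR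
      | 2, R, x, ⟨y, hy⟩ =>
        have hl := congrArg List.length hy
        rw [List.length_append, MSeq.length_coext, MSeq.length_coext] at hl
        rcases hc (x 0) (x 1) with ⟨w, hw⟩ | hp
        · have hl' := congrArg List.length hw
          rw [List.length_append] at hl'
          -- The coextended paths differ by one step, hence so do the original ones; the label of
          -- that step is then read off from the coextension.
          obtain ⟨⟨R', z⟩, rfl⟩ := List.length_eq_one_iff.1
            (show w.length = 1 by simp at hl; omega)
          have h3 := MSeq.coext_step g h0 hw.symm
          rw [h3] at hy
          have : R' = R := by simpa using congrArg (fun l => l.getLast?.map Prod.fst) hy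
          exact ⟨z, by rw [← hw, this]⟩
        · have := hp.length_le
          simp at hl
          omega

end Modal

/-! ### Existential modal logic -/

section ModalLogic

variable {σ : FirstOrder.Language.{0, 0}}

namespace ModalFormula

theorem exists_conj {ι : Type} [Finite ι] (χ : ι → ModalFormula σ) (j : ℕ)
    (hχ : ∀ i, (χ i).IsExistential ∧ (χ i).depth ≤ j) :
    ∃ ψ : ModalFormula σ, (ψ.IsExistential ∧ ψ.depth ≤ j) ∧
      ∀ (A : Type u) [σ.Structure A] (a : A), ψ.Sat a ↔ ∀ i, (χ i).Sat a := by
  classical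
  have : Fintype ι := Fintype.ofFinite ι
  suffices h : ∀ s : Finset ι, ∃ ψ : ModalFormula σ, (ψ.IsExistential ∧ ψ.depth ≤ j) ∧
      ∀ (A : Type u) [σ.Structure A] (a : A), ψ.Sat a ↔ ∀ i ∈ s, (χ i).Sat a by
    simpa using h Finset.univ
  intro s
  induction s using Finset.induction_on with
  | empty => exact ⟨.verum, ⟨.verum, Nat.zero_le _⟩, by simp [Sat]⟩
  | insert i s _ ih =>
    obtain ⟨ψ, hψ, h⟩ := ih
    exact ⟨.and (χ i) ψ, ⟨.and (hχ i).1 hψ.1, max_le (hχ i).2 hψ.2⟩, by simp [Sat, h]⟩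

/-- The formula `P` or its negation. -/
noncomputable def literal (P : σ.Relations 1) : Prop → ModalFormula σ :=
  open Classical in fun p => if p then .var P else .neg (.var P)

theorem literal_isExistential (P : σ.Relations 1) (p : Prop) :
    (literal P p).IsExistential ∧ (literal P p).depth = 0 := by
  unfold literal
  split
  · exact ⟨.var P, rfl⟩
  · exact ⟨.neg_var P, rfl⟩

theorem sat_literal {A : Type u} [σ.Structure A] (P : σ.Relations 1) (p : Prop) (a : A) :
    (literal P p).Sat a ↔ (p ↔ Language.Structure.RelMap P ![a]) := by
  unfold literal
  split <;> simp_all [Sat]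

end ModalFormula

/-- Existence of a winning strategy in the existential simulation game with `j` rounds. -/
def ModalSimulated {A B : Type u} [σ.Structure A] [σ.Structure B] : ℕ → A → B → Prop
  | 0, a, b => ∀ P : σ.Relations 1, Language.Structure.RelMap P ![a] ↔
      Language.Structure.RelMap P ![b]
  | j + 1, a, b => (∀ P : σ.Relations 1, Language.Structure.RelMap P ![a] ↔
      Language.Structure.RelMap P ![b]) ∧
      ∀ (R : σ.Relations 2) (a' : A), Language.Structure.RelMap R ![a, a'] →
        ∃ b' : B, Language.Structure.RelMap R ![b, b'] ∧ ModalSimulated j a' b'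

variable {A B : Type u} [σ.Structure A] [σ.Structure B]

theorem ModalSimulated.atomic {j : ℕ} {a : A} {b : B} (h : ModalSimulated (σ := σ) j a b)
    (P : σ.Relations 1) : Language.Structure.RelMap P ![a] ↔ Language.Structure.RelMap P ![b] := by
  cases j with
  | zero => exact h P
  | succ j => exact h.1 P

/-- The formula for a describes its unary symbols exactly, negations included, and asserts one
diamond for each characteristic formula realised at a successor. Keeping the family finite at depth
j makes the conjunction at depth j + 1 finite, even if a has infinitely many successors. -/
theorem ModalFormula.exists_characteristic (hσ : Finite (Σ n, σ.Relations n)) (A B : Type u)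
    [σ.Structure A] [σ.Structure B] (j : ℕ) :
    ∃ (ι : Type) (_ : Finite ι) (χ : ι → ModalFormula σ),
      (∀ i, (χ i).IsExistential ∧ (χ i).depth ≤ j) ∧
      ∀ a : A, ∃ i, (χ i).Sat a ∧ ∀ b : B, (χ i).Sat b → ModalSimulated (σ := σ) j a b := by
  have hf : ∀ n, Finite (σ.Relations n) := fun n =>
    Finite.of_injective (Sigma.mk n : _ → Σ n, σ.Relations n) sigma_mk_injective
  induction j with
  | zero =>
    have h := fun L : Set (σ.Relations 1) => exists_conj.{u} (fun P => literal P (P ∈ L)) 0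
      fun P => ⟨(literal_isExistential P _).1, (literal_isExistential P _).2.le⟩
    choose ψ hψ hs using h
    refine ⟨_, inferInstance, ψ, hψ, fun a =>
      ⟨{P | Language.Structure.RelMap P ![a]}, ?_, fun b hb P => ?_⟩⟩
    · simp [hs, sat_literal]
    · simp only [hs, sat_literal] at hb
      exact hb P
  | succ j ih =>
    obtain ⟨ι, _, χ, hχ, hc⟩ := ih
    -- An index prescribes the unary symbols that hold and the pairs (R, i) for which some
    -- R-successor satisfies `χ i`. All possible indices are used, so finiteness does not depend on
    -- A.
    have h := fun L : Set (σ.Relations 1) × Set (σ.Relations 2 × ι) =>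
      exists_conj.{u} (Sum.elim (fun P => literal P (P ∈ L.1))
        fun q : L.2 => .dia q.1.1 (χ q.1.2)) (j + 1) (by
        rintro (P | q)
        · exact ⟨(literal_isExistential P _).1, (literal_isExistential P _).2.trans_le
            (Nat.zero_le _)⟩
        · exact ⟨.dia _ (hχ _).1, Nat.succ_le_succ (hχ _).2⟩)
    choose ψ hψ hs using h
    simp only [Sum.forall, Sum.elim_inl, Sum.elim_inr, sat_literal, Sat] at hs
    refine ⟨_, inferInstance, ψ, hψ, fun a =>
      ⟨({P | Language.Structure.RelMap P ![a]},
        {q | ∃ a' : A, Language.Structure.RelMap q.1 ![a, a'] ∧ (χ q.2).Sat a'}), ?_,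
        fun b hb => ?_⟩⟩
    · rw [hs]
      exact ⟨fun P => Iff.rfl, fun q => q.2⟩
    · rw [hs] at hb
      refine ⟨hb.1, fun R a' ha' => ?_⟩
      obtain ⟨i, hi, hi'⟩ := hc a'
      obtain ⟨b', hb', hb''⟩ := hb.2 ⟨(R, i), a', ha', hi⟩
      exact ⟨b', hb', hi' b' hb''⟩

theorem modalSimulated_of_preservesExistsML (hσ : Finite (Σ n, σ.Relations n)) {k : ℕ}
    {A B : PStr.{u} σ} (h : PreservesExistsML k A B) : ModalSimulated (σ := σ) k A.pt B.pt := by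
  obtain ⟨ι, _, χ, hχ, hc⟩ :=
    ModalFormula.exists_characteristic hσ A.toStr.carrier B.toStr.carrier k
  obtain ⟨i, hi, hi'⟩ := hc A.pt
  exact hi' _ (h _ (hχ i) hi)

theorem walkLast_append {A : Type u} (a : A) (l : List (σ.Relations 2 × A))
    (m : σ.Relations 2 × A) : walkLast a (l ++ [m]) = m.2 := by
  simp [walkLast]

/-- The extension of a path by a step. -/
def MSeq.snoc {k : ℕ} {a : A} (s : MSeq (σ := σ) k A a) (hs : s.1.length < k)
    (R : σ.Relations 2) (x : A) (h : Language.Structure.RelMap R ![s.last, x]) :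
    MSeq (σ := σ) k A a :=
  ⟨s.1 ++ [(R, x)], by simpa using hs, fun j hj => by
    rw [List.length_append] at hj
    rcases lt_or_ge j s.1.length with hj' | hj'
    · rw [List.getElem_append_left hj', List.take_append_of_le_length hj'.le]
      exact s.2.2 j hj'
    · have e : j = s.1.length := by simp at hj; omega
      subst e
      simpa [MSeq.last] using h⟩

/-! ### Modal strategies and pathwise embeddings -/

variable [σ.IsRelational]

theorem ModComonad.exists_isPathwise_of_modalSimulated {k : ℕ} {A B : PStr.{u} σ}
    (h : ModalSimulated (σ := σ) k A.pt B.pt) :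
    ∃ f : ModCofree k A ⟶ ModCofree k B, ModComonad.IsPathwise f := by
  refine ModComonad.exists_isPathwise_iff.2 ?_
  obtain ⟨G, hG0, hG1, hG2⟩ := exists_unfolding (α := σ.Relations 2 × A.toStr.carrier)
    (β := Unit) (T := B.toStr.carrier)
    (fun l => l.length ≤ k ∧ ∀ (j : ℕ) (hj : j < l.length),
      Language.Structure.RelMap l[j].1 ![walkLast A.pt (l.take j), l[j].2])
    (fun l x hl => by
      refine ⟨by have := hl.1; simp at this; omega, fun j hj => ?_⟩
      have := hl.2 j (by simp; omega)
      rwa [List.getElem_append_left hj, List.take_append_of_le_length hj.le] at this)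
    -- The state is Duplicator's current element, and the invariant says that the remaining rounds
    -- can still be survived.
    (fun l b => ModalSimulated (σ := σ) (k - l.length) (walkLast A.pt l) b)
    (fun b m _ b' => Language.Structure.RelMap m.1 ![b, b']) B.pt h
    (fun l x b hl hb => by
      have h1 := hl.1
      have h2 := hl.2 l.length (by simp)
      rw [List.length_append, List.length_singleton] at h1
      obtain ⟨j, hj⟩ : ∃ j, k - l.length = j + 1 := ⟨k - l.length - 1, by omega⟩
      rw [hj] at hb
      simp only [List.getElem_concat_length, List.take_left'] at h2
      obtain ⟨b', hb1, hb2⟩ := hb.2 _ _ h2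
      refine ⟨(), b', hb1, ?_⟩
      rwa [walkLast_append, List.length_append, List.length_singleton,
        show k - (l.length + 1) = j by omega])
  refine ⟨fun s => G s.1, hG0, fun P s => (hG1 s.1 s.2).atomic P, fun R x s t e => ?_⟩
  have ht := t.2
  obtain ⟨-, h1⟩ := hG2 s.1 (R, x) (by rw [← e]; exact ht)
  rw [← e] at h1
  exact h1

theorem ModComonad.preservesExistsML_of_isPathwise {k : ℕ} {A B : PStr.{u} σ}
    (h : ∃ f : ModCofree k A ⟶ ModCofree k B, ModComonad.IsPathwise f) :
    PreservesExistsML k A B := by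
  obtain ⟨h, h0, h1, h2⟩ := ModComonad.exists_isPathwise_iff.1 h
  -- The bound leaves enough room in `s` for the steps that the diamonds of φ still require.
  suffices key : ∀ φ : ModalFormula σ, φ.IsExistential →
      ∀ s : MSeq (σ := σ) k A.toStr.carrier A.pt, s.1.length + φ.depth ≤ k →
        φ.Sat s.last → φ.Sat (h s) by
    intro φ hφ hA
    have := key φ hφ.1 (MSeq.root k A.pt) ((Nat.zero_add _).trans_le hφ.2) hA
    rwa [h0] at this
  intro φ hφ
  induction hφ with
  | var P => exact fun s _ => (h1 P s).1
  | neg_var P => exact fun s _ => (not_congr (h1 P s)).1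
  | verum => exact fun _ _ => id
  | falsum => exact fun _ _ => id
  | and _ _ ih1 ih2 =>
    intro s hs hA
    rw [ModalFormula.depth] at hs
    exact ⟨ih1 s (by omega) hA.1, ih2 s (by omega) hA.2⟩
  | or _ _ ih1 ih2 =>
    intro s hs hA
    rw [ModalFormula.depth] at hs
    exact hA.imp (ih1 s (by omega)) (ih2 s (by omega))
  | dia R _ ih =>
    rintro s hs ⟨x, hx, hA⟩
    rw [ModalFormula.depth] at hs
    refine ⟨_, h2 R x s (s.snoc (by omega) R x hx) rfl, ih _ ?_ ?_⟩
    · simp only [MSeq.snoc, List.length_append, List.length_singleton]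
      omega
    · rwa [MSeq.last, MSeq.snoc, walkLast_append]

end ModalLogic

/-! ### Existential infinitary logic -/

section Infinitary

variable {σ : FirstOrder.Language.{0, 0}} {k : ℕ} {A B : Type u} [σ.Structure A] [σ.Structure B]

/-- Existential formulas true under one assignment are true under the other. -/
def LPreserves (σ : FirstOrder.Language.{0, 0}) {A B : Type u} [σ.Structure A] [σ.Structure B]
    {S : Set (Fin k)} (v : S → A) (w : S → B) : Prop :=
  ∀ φ : LFormula.{u} σ k S, φ.IsExistential → φ.Realize v → φ.Realize w

/-- Negated atoms are existential formulas, so preserving them amounts to reflecting atoms. -/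
theorem LPreserves.relMap_iff {S : Set (Fin k)} {v : S → A} {w : S → B} (h : LPreserves σ v w)
    {n : ℕ} (R : σ.Relations n) (x : Fin n → S) :
    Language.Structure.RelMap R (fun i => v (x i)) ↔
      Language.Structure.RelMap R (fun i => w (x i)) :=
  ⟨h _ (.rel R x), fun hw => by_contra fun hv => h _ (.neg_rel R x) hv hw⟩

theorem LPreserves.eq_iff {S : Set (Fin k)} {v : S → A} {w : S → B} (h : LPreserves σ v w)
    (i j : S) : v i = v j ↔ w i = w j :=
  ⟨h _ (.equal i j), fun hw => by_contra fun hv => h _ (.neg_equal i j) hv hw⟩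

/-- If each answer b failed, some existential φ_b would hold at a and fail at b. The formula ∃x_i
⋀_b φ_b holds in A, so it holds in B at some b, contradicting the choice of φ_b. The conjunction
ranges over all of B, which is where infinitary logic enters. -/
theorem LPreserves.exists_assign {S : Set (Fin k)} {v : S → A} {w : S → B}
    (h : LPreserves σ v w) (i : Fin k) (a : A) :
    ∃ b : B, LPreserves σ (LFormula.assign v i a) (LFormula.assign w i b) := by
  by_contra! hc
  simp only [LPreserves, not_forall] at hc
  choose φ hφ hv hw using hc
  obtain ⟨b, hb⟩ := h (.ex i (.conj φ)) (.ex i (.conj hφ)) ⟨a, hv⟩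
  exact hw b (hb b)

theorem LFormula.assign_self {A : Type u} {S : Set (Fin k)} (v : S → A) (i : Fin k) (a : A) :
    assign v i a ⟨i, Set.mem_insert _ _⟩ = a := dif_pos rfl

theorem LFormula.assign_of_ne {A : Type u} {S : Set (Fin k)} (v : S → A) (i : Fin k) (a : A)
    {j : Fin k} (h : j ≠ i) (hj : j ∈ S) :
    assign v i a ⟨j, Set.mem_insert_of_mem _ hj⟩ = v ⟨j, hj⟩ := dif_neg h

theorem LFormula.comp_assign {A B : Type u} {S : Set (Fin k)} (f : A → B) (v : S → A) (i : Fin k)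
    (a : A) : (fun j => f (assign v i a j)) = assign (fun j => f (v j)) i (f a) := by
  funext j
  unfold assign
  split <;> rfl

/-! ### Pebble plays as variable assignments -/

variable [σ.IsRelational]

/-- The last move in a sequence with a given prefix is that of the prefix, unless its pebble is
moved again. -/
def PSeq.ActiveIn {A : Type u} (s : PSeq k A) (l : List (Fin k × A)) : Prop :=
  ∃ w, s.1 ++ w = l ∧ s.pebble ∉ w.map Prod.fst

theorem PSeq.active_of_activeIn {A : Type u} {n : ℕ} {s : Fin n → PSeq k A}
    {l : List (Fin k × A)} (h : ∀ i, (s i).ActiveIn l) : PSeq.Active s := by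
  refine ⟨fun i j => ?_, fun i j w hw => ?_⟩
  · obtain ⟨w, hw, -⟩ := h i
    obtain ⟨w', hw', -⟩ := h j
    exact List.prefix_or_prefix_of_prefix ⟨w, hw⟩ ⟨w', hw'⟩
  · obtain ⟨z, hz, hp⟩ := h i
    obtain ⟨z', hz', -⟩ := h j
    rw [← hz', ← hw, List.append_assoc, List.append_cancel_left_eq] at hz
    rw [hz, List.map_append, List.mem_append, not_or] at hp
    exact hp.1

theorem PSeq.Active.exists_activeIn {A : Type u} {n : ℕ} {s : Fin n → PSeq k A}
    (h : PSeq.Active s) : ∃ l, ∀ i, (s i).ActiveIn l := by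
  rcases exists_common_extension (fun i => (s i).1) h.1 with rfl | ⟨j, hj⟩
  · exact ⟨[], fun i => i.elim0⟩
  · refine ⟨(s j).1, fun i => ?_⟩
    obtain ⟨w, hw⟩ := hj i
    exact ⟨w, hw, h.2 i j w hw⟩

/-- The extension of a sequence by a move. -/
def PSeq.snoc {A : Type u} (l : List (Fin k × A)) (p : Fin k) (a : A) : PSeq k A :=
  ⟨l ++ [(p, a)], by simp⟩

theorem PSeq.lastMove_snoc {A : Type u} (l : List (Fin k × A)) (p : Fin k) (a : A) :
    (PSeq.snoc l p a).lastMove = (p, a) := List.getLast_append_singleton _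

/-- Moving pebble p deactivates the earlier prefix whose pebble is p and activates the whole play.
Reassigning the variable x_p has the same effect on an assignment. -/
theorem PSeq.activeIn_snoc_iff {A : Type u} {s : PSeq k A} {l : List (Fin k × A)} {p : Fin k}
    {a : A} : s.ActiveIn (l ++ [(p, a)]) ↔ s = PSeq.snoc l p a ∨ s.ActiveIn l ∧ s.pebble ≠ p := by
  constructor
  · rintro ⟨w, hw, hp⟩
    induction w using List.reverseRecOn with
    | nil => exact Or.inl (Subtype.ext ((List.append_nil _).symm.trans hw))
    | append_singleton w m _ =>
      rw [← List.append_assoc] at hw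
      obtain ⟨h1, h2⟩ := List.append_inj' hw rfl
      obtain rfl := List.singleton_injective h2
      simp only [List.map_append, List.mem_append, not_or, List.map_singleton,
        List.mem_singleton] at hp
      exact Or.inr ⟨⟨w, h1, hp.1⟩, hp.2⟩
  · rintro (rfl | ⟨⟨w, hw, hp⟩, hn⟩)
    · exact ⟨[], List.append_nil _, by simp⟩
    · refine ⟨w ++ [(p, a)], by rw [← List.append_assoc, hw], ?_⟩
      simpa using ⟨by simpa using hp, hn⟩

/-- In J(A) and J(B) the symbol I is the diagonal, so its instance of the general criterion is the
condition on equality. -/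
theorem PebComonad.exists_isPathwise_cofreeI_iff {A B : Str.{u} σ} :
    (∃ f : PebCofreeI k A ⟶ PebCofreeI k B, PebComonad.IsPathwise f) ↔
    ∃ h : PSeq k A.carrier → B.carrier,
      (∀ (n : ℕ) (R : σ.Relations n) (s : Fin n → PSeq k A.carrier), PSeq.Active s →
        (Language.Structure.RelMap R (fun i => (s i).last) ↔
          Language.Structure.RelMap R (fun i => h (s i)))) ∧
      ∀ s : Fin 2 → PSeq k A.carrier, PSeq.Active s →
        ((s 0).last = (s 1).last ↔ h (s 0) = h (s 1)) := by
  refine PebComonad.exists_isPathwise_iff.trans (exists_congr fun h => ⟨fun hh =>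
    ⟨fun n R => hh n (Sum.inl R), hh 2 (Sum.inr IRel.I)⟩, fun hh n R => ?_⟩)
  match n, R with
  | n, Sum.inl R => exact hh.1 n R
  | _, Sum.inr IRel.I => exact hh.2

theorem PebComonad.exists_isPathwise_of_preservesExistsL {A B : Str.{u} σ}
    (h : PreservesExistsL k A B) :
    ∃ f : PebCofreeI k A ⟶ PebCofreeI k B, PebComonad.IsPathwise f := by
  refine PebComonad.exists_isPathwise_cofreeI_iff.2 ?_
  -- A state is the set of variables assigned so far, with their values in A and in B. A move (p, a)
  -- reassigns x_p on both sides.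
  let T := Σ S : Set (Fin k), (S → A.carrier) × (S → B.carrier)
  obtain ⟨G, -, hG1, hG2⟩ := exists_unfolding (α := Fin k × A.carrier) (β := B.carrier) (T := T)
    (fun _ => True) (fun _ _ _ => trivial) (fun _ t => LPreserves σ t.2.1 t.2.2)
    (fun t m b t' => t' = ⟨insert m.1 t.1, LFormula.assign t.2.1 m.1 m.2,
      LFormula.assign t.2.2 m.1 b⟩)
    ⟨∅, fun i => absurd i.2 (Set.notMem_empty _), fun i => absurd i.2 (Set.notMem_empty _)⟩
    h
    (fun l m t _ ht => by
      obtain ⟨b, hb⟩ := ht.exists_assign m.1 m.2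
      exact ⟨b, _, rfl, hb⟩)
  have hval : ∀ s : PSeq k A.carrier, ∃ b, G s.1 = ⟨insert s.pebble (G s.1.dropLast).1,
      LFormula.assign (G s.1.dropLast).2.1 s.pebble s.last,
      LFormula.assign (G s.1.dropLast).2.2 s.pebble b⟩ := fun s => by
    obtain ⟨b, hb⟩ := hG2 s.1.dropLast s.lastMove trivial
    refine ⟨b, ?_⟩
    conv_lhs => rw [← List.dropLast_append_getLast s.2]
    exact hb
  choose g hg using hval
  -- The prefixes active in `l` are recorded by the state at `l`, each under the variable of its
  -- pebble. Atomic facts about them are thus facts about one pair of assignments.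
  have key : ∀ l, ∀ s : PSeq k A.carrier, s.ActiveIn l →
      ∃ i : (G l).1, i.1 = s.pebble ∧ (G l).2.1 i = s.last ∧ (G l).2.2 i = g s := by
    intro l
    induction l using List.reverseRecOn with
    | nil =>
      rintro s ⟨w, hw, -⟩
      exact absurd (List.append_eq_nil_iff.1 hw).1 s.2
    | append_singleton l m ih =>
      intro s hs
      have hs1 : (PSeq.snoc l m.1 m.2).1.dropLast = l := List.dropLast_concat
      have hs2 := PSeq.lastMove_snoc l m.1 m.2
      have hGm := hg (PSeq.snoc l m.1 m.2)
      rw [hs1, PSeq.pebble, PSeq.last, hs2] at hGm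
      change G (l ++ [m]) = _ at hGm
      rw [hGm]
      rcases PSeq.activeIn_snoc_iff.1 hs with rfl | ⟨h1, h2⟩
      · refine ⟨⟨m.1, Set.mem_insert _ _⟩, ?_, ?_, ?_⟩
        · exact (congrArg Prod.fst hs2).symm
        · exact (LFormula.assign_self _ _ _).trans (congrArg Prod.snd hs2).symm
        · exact LFormula.assign_self _ _ _
      · obtain ⟨i, hi1, hi2, hi3⟩ := ih s h1
        have hne : i.1 ≠ m.1 := hi1 ▸ h2
        exact ⟨⟨i.1, Set.mem_insert_of_mem _ i.2⟩, hi1,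
          (LFormula.assign_of_ne _ _ _ hne _).trans hi2,
          (LFormula.assign_of_ne _ _ _ hne _).trans hi3⟩
  refine ⟨g, fun n R s hs => ?_, fun s hs => ?_⟩
  all_goals
    obtain ⟨l, hl⟩ := hs.exists_activeIn
    choose i _ hi1 hi2 using fun j => key l (s j) (hl j)
    simp only [← hi1, ← hi2]
  · exact (hG1 l trivial).relMap_iff R i
  · exact (hG1 l trivial).eq_iff (i 0) (i 1)

theorem PebComonad.preservesExistsL_of_isPathwise {A B : Str.{u} σ}
    (h : ∃ f : PebCofreeI k A ⟶ PebCofreeI k B, PebComonad.IsPathwise f) :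
    PreservesExistsL k A B := by
  obtain ⟨h, hh, hh'⟩ := PebComonad.exists_isPathwise_cofreeI_iff.1 h
  -- A free variable x_i is interpreted by a prefix of the play `l` at which pebble i was last
  -- moved.
  suffices key : ∀ (S : Set (Fin k)) (φ : LFormula.{u} σ k S), φ.IsExistential →
      ∀ (l : List (Fin k × A.carrier)) (q : S → PSeq k A.carrier),
        (∀ i, (q i).ActiveIn l ∧ (q i).pebble = i.1) →
        φ.Realize (fun i => (q i).last) → φ.Realize (fun i => h (q i)) by
    intro φ hφ hA
    have := key ∅ φ hφ [] (fun i => absurd i.2 (Set.notMem_empty _))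
      (fun i => absurd i.2 (Set.notMem_empty _))
    have e : ∀ {D : Type u} (v w : (∅ : Set (Fin k)) → D), v = w := fun v w =>
      funext fun i => absurd i.2 (Set.notMem_empty _)
    rw [e (fun i : (∅ : Set (Fin k)) => PSeq.last _) _,
      e (fun i : (∅ : Set (Fin k)) => h _) _] at this
    exact this hA
  intro S φ hφ
  have hrel : ∀ {S : Set (Fin k)} {n : ℕ} (R : σ.Relations n) (x : Fin n → S)
      (l : List (Fin k × A.carrier)) (q : S → PSeq k A.carrier),
      (∀ i, (q i).ActiveIn l ∧ (q i).pebble = i.1) →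
      (Language.Structure.RelMap R (fun i => (q (x i)).last) ↔
        Language.Structure.RelMap R (fun i => h (q (x i)))) := fun R x l q hq =>
    hh _ R (fun i => q (x i)) (PSeq.active_of_activeIn fun i => (hq (x i)).1)
  have heq : ∀ {S : Set (Fin k)} (i j : S)
      (l : List (Fin k × A.carrier)) (q : S → PSeq k A.carrier),
      (∀ i, (q i).ActiveIn l ∧ (q i).pebble = i.1) →
      ((q i).last = (q j).last ↔ h (q i) = h (q j)) := fun i j l q hq =>
    hh' (fun m => q (![i, j] m)) (PSeq.active_of_activeIn fun m => (hq _).1)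
  induction hφ with
  | equal i j => exact fun l q hq => (heq i j l q hq).1
  | rel R x => exact fun l q hq => (hrel R x l q hq).1
  | neg_equal i j => exact fun l q hq => (not_congr (heq i j l q hq)).1
  | neg_rel R x => exact fun l q hq => (not_congr (hrel R x l q hq)).1
  | conj _ ih => exact fun l q hq hA i => ih i l q hq (hA i)
  | disj _ ih => exact fun l q hq ⟨i, hA⟩ => ⟨i, ih i l q hq hA⟩
  | ex i _ ih =>
    rintro l q hq ⟨a, ha⟩
    have hl := PSeq.lastMove_snoc l i a
    refine ⟨h (PSeq.snoc l i a), ?_⟩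
    -- The witness is Duplicator's answer when pebble i is moved to a; the other variables keep
    -- their prefixes, which remain active.
    have := ih (l ++ [(i, a)]) (LFormula.assign q i (PSeq.snoc l i a)) ?_
    · rw [LFormula.comp_assign PSeq.last, LFormula.comp_assign h] at this
      apply this
      rwa [show (PSeq.snoc l i a).last = a from congrArg Prod.snd hl]
    · intro j
      by_cases hj : j.1 = i
      · rw [LFormula.assign, dif_pos hj, hj]
        exact ⟨PSeq.activeIn_snoc_iff.2 (Or.inl rfl), congrArg Prod.fst hl⟩
      · rw [LFormula.assign, dif_neg hj]
        have := hq ⟨j.1, j.2.resolve_left hj⟩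
        exact ⟨PSeq.activeIn_snoc_iff.2
          (Or.inr ⟨this.1, fun e => hj (this.2.symm.trans e)⟩), this.2⟩

end Infinitary

/-! ### Existential first-order logic -/

section FO

variable {σ : FirstOrder.Language.{0, 0}}

/-- The atomic formulas without terms other than variables. -/
def FOAtom (σ : FirstOrder.Language.{0, 0}) (n : ℕ) : Type :=
  (Σ R : (Σ m, σ.Relations m), Fin R.1 → Fin n) ⊕ (Fin n × Fin n)

theorem FOAtom.finite (hσ : Finite (Σ n, σ.Relations n)) (n : ℕ) : Finite (FOAtom σ n) :=
  inferInstanceAs (Finite (_ ⊕ _))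

/-- An atom as a formula. -/
def FOAtom.toFormula {n : ℕ} : FOAtom σ n → σ.BoundedFormula Empty n
  | .inl R => R.1.2.boundedFormula fun i => .var (.inr (R.2 i))
  | .inr p => Language.Term.bdEqual (.var (.inr p.1)) (.var (.inr p.2))

theorem FOAtom.isAtomic {n : ℕ} (t : FOAtom σ n) : t.toFormula.IsAtomic := by
  rcases t with R | p
  · exact .rel _ _
  · exact .equal _ _

/-- An atom or its negation. -/
noncomputable def FOAtom.literal {n : ℕ} (t : FOAtom σ n) (p : Prop) : σ.BoundedFormula Empty n :=
  open Classical in if p then t.toFormula else t.toFormula.not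

theorem FOAtom.literal_isExistentialFO {n : ℕ} (t : FOAtom σ n) (p : Prop) :
    IsExistentialFO (t.literal p) ∧ quantifierRank (t.literal p) = 0 := by
  have h : quantifierRank t.toFormula = 0 := by rcases t with R | p <;> rfl
  unfold literal
  split
  · exact ⟨.atom t.isAtomic, h⟩
  · exact ⟨.neg_atom t.isAtomic, (congrArg (max · 0) h).trans (max_self 0)⟩

theorem FOAtom.realize_literal {A : Type u} [σ.Structure A] {n : ℕ} (t : FOAtom σ n) (p : Prop)
    (v : Fin n → A) :
    (t.literal p).Realize default v ↔ (p ↔ t.toFormula.Realize default v) := by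
  unfold literal
  split <;> simp_all

theorem exists_conjFO {n : ℕ} {ι : Type} [Finite ι] (χ : ι → σ.BoundedFormula Empty n) (j : ℕ)
    (hχ : ∀ i, IsExistentialFO (χ i) ∧ quantifierRank (χ i) ≤ j) :
    ∃ ψ : σ.BoundedFormula Empty n, (IsExistentialFO ψ ∧ quantifierRank ψ ≤ j) ∧
      ∀ (A : Type u) [σ.Structure A] (v : Fin n → A),
        ψ.Realize default v ↔ ∀ i, (χ i).Realize default v := by
  classical
  have : Fintype ι := Fintype.ofFinite ι
  suffices h : ∀ s : Finset ι, ∃ ψ : σ.BoundedFormula Empty n,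
      (IsExistentialFO ψ ∧ quantifierRank ψ ≤ j) ∧
      ∀ (A : Type u) [σ.Structure A] (v : Fin n → A),
        ψ.Realize default v ↔ ∀ i ∈ s, (χ i).Realize default v by
    simpa using h Finset.univ
  intro s
  induction s using Finset.induction_on with
  | empty => exact ⟨⊤, ⟨.verum, Nat.zero_le _⟩, by simp⟩
  | insert i s _ ih =>
    obtain ⟨ψ, hψ, h⟩ := ih
    refine ⟨χ i ⊓ ψ, ⟨.and (hχ i).1 hψ.1, ?_⟩, by simp [h]⟩
    -- Conjunction is encoded by implications into ⊥, which contribute the zeros.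
    change max (max (quantifierRank (χ i)) (max (quantifierRank ψ) 0)) 0 ≤ j
    have := (hχ i).2
    have := hψ.2
    omega

/-- Tuples that satisfy the same atomic formulas. -/
def SameAtoms (σ : FirstOrder.Language.{0, 0}) {A B : Type u} [σ.Structure A] [σ.Structure B]
    {n : ℕ} (v : Fin n → A) (w : Fin n → B) : Prop :=
  ∀ t : FOAtom σ n, t.toFormula.Realize default v ↔ t.toFormula.Realize default w

/-- Existence of a winning strategy in the existential Ehrenfeucht–Fraïssé game with `j` rounds. -/
def FOSimulated (σ : FirstOrder.Language.{0, 0}) {A B : Type u} [σ.Structure A] [σ.Structure B] :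
    ∀ (_ : ℕ) {n : ℕ}, (Fin n → A) → (Fin n → B) → Prop
  | 0, _, v, w => SameAtoms σ v w
  | j + 1, _, v, w => SameAtoms σ v w ∧
      ∀ a : A, ∃ b : B, FOSimulated σ j (Fin.snoc v a : Fin _ → A) (Fin.snoc w b : Fin _ → B)

variable {A B : Type u} [σ.Structure A] [σ.Structure B]

theorem FOSimulated.sameAtoms {j n : ℕ} {v : Fin n → A} {w : Fin n → B}
    (h : FOSimulated σ j v w) : SameAtoms σ v w := by
  cases j with
  | zero => exact h
  | succ j => exact h.1

theorem SameAtoms.relMap_iff {n : ℕ} {v : Fin n → A} {w : Fin n → B} (h : SameAtoms σ v w)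
    {m : ℕ} (R : σ.Relations m) (x : Fin m → Fin n) :
    Language.Structure.RelMap R (fun i => v (x i)) ↔
      Language.Structure.RelMap R (fun i => w (x i)) := by
  have := h (.inl ⟨⟨m, R⟩, x⟩)
  simpa [FOAtom.toFormula, Language.BoundedFormula.realize_rel] using this

theorem SameAtoms.eq_iff {n : ℕ} {v : Fin n → A} {w : Fin n → B} (h : SameAtoms σ v w)
    (i j : Fin n) : v i = v j ↔ w i = w j := by
  have := h (.inr (i, j))
  simpa [FOAtom.toFormula] using this

theorem quantifierRank_ex {n : ℕ} (φ : σ.BoundedFormula Empty (n + 1)) :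
    quantifierRank φ.ex = quantifierRank φ + 1 := by
  change max (max (quantifierRank φ) 0 + 1) 0 = _
  omega

/-- The formula for a tuple decides every atom and asserts an existential for each formula of rank j
realised by some one-element extension. A finite vocabulary without terms other than variables gives
finitely many atoms in n variables, so the family stays finite. The number n varies in the induction
because each round adds a variable. -/
theorem exists_characteristicFO (hσ : Finite (Σ n, σ.Relations n)) (A B : Type u)
    [σ.Structure A] [σ.Structure B] (j n : ℕ) :
    ∃ (ι : Type) (_ : Finite ι) (χ : ι → σ.BoundedFormula Empty n),
      (∀ i, IsExistentialFO (χ i) ∧ quantifierRank (χ i) ≤ j) ∧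
      ∀ v : Fin n → A, ∃ i, (χ i).Realize default v ∧
        ∀ w : Fin n → B, (χ i).Realize default w → FOSimulated σ j v w := by
  induction j generalizing n with
  | zero =>
    have := FOAtom.finite hσ n
    have h := fun L : Set (FOAtom σ n) =>
      exists_conjFO.{u} (fun t : FOAtom σ n => t.literal (t ∈ L)) 0
      fun t => ⟨(t.literal_isExistentialFO _).1, (t.literal_isExistentialFO _).2.le⟩
    choose ψ hψ hs using h
    refine ⟨_, inferInstance, ψ, hψ, fun v =>
      ⟨{t | t.toFormula.Realize default v}, ?_, fun w hw t => ?_⟩⟩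
    · simp [hs, FOAtom.realize_literal]
    · simp only [hs, FOAtom.realize_literal] at hw
      exact hw t
  | succ j ih =>
    have := FOAtom.finite hσ n
    obtain ⟨ι, _, χ, hχ, hc⟩ := ih (n + 1)
    have h := fun L : Set (FOAtom σ n) × Set ι =>
      exists_conjFO.{u} (Sum.elim (fun t : FOAtom σ n => t.literal (t ∈ L.1))
        fun i : L.2 => (χ i.1).ex) (j + 1) (by
        rintro (t | i)
        · exact ⟨(t.literal_isExistentialFO _).1, (t.literal_isExistentialFO _).2.trans_le
            (Nat.zero_le _)⟩
        · exact ⟨.ex (hχ _).1, (quantifierRank_ex _).trans_le (Nat.succ_le_succ (hχ _).2)⟩)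
    choose ψ hψ hs using h
    simp only [Sum.forall, Sum.elim_inl, Sum.elim_inr, FOAtom.realize_literal,
      Language.BoundedFormula.realize_ex] at hs
    refine ⟨_, inferInstance, ψ, hψ, fun v =>
      ⟨({t | t.toFormula.Realize default v},
        {i | ∃ a : A, (χ i).Realize default (Fin.snoc v a : Fin _ → A)}), ?_, fun w hw => ?_⟩⟩
    · rw [hs]
      exact ⟨fun t => Iff.rfl, fun i => i.2⟩
    · rw [hs] at hw
      refine ⟨hw.1, fun a => ?_⟩
      obtain ⟨i, hi, hi'⟩ := hc (Fin.snoc v a)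
      obtain ⟨b, hb⟩ := hw.2 ⟨i, a, hi⟩
      exact ⟨b, hi' _ hb⟩

theorem foSimulated_of_preservesExistsFO (hσ : Finite (Σ n, σ.Relations n)) {k : ℕ}
    {A B : Str.{u} σ} (h : PreservesExistsFO k A B) :
    FOSimulated σ k (default : Fin 0 → A.carrier) (default : Fin 0 → B.carrier) := by
  obtain ⟨ι, _, χ, hχ, hc⟩ := exists_characteristicFO hσ A.carrier B.carrier k 0
  obtain ⟨i, hi, hi'⟩ := hc default
  exact hi' _ (h _ (hχ i) hi)

/-! ### First-order strategies and pathwise embeddings -/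

variable [σ.IsRelational] {k : ℕ}

theorem EFComonad.exists_isPathwise_cofreeI_iff {A B : Str.{u} σ} :
    (∃ f : EFCofreeI k A ⟶ EFCofreeI k B, EFComonad.IsPathwise f) ↔
    ∃ h : ESeq k A.carrier → B.carrier,
      (∀ (n : ℕ) (R : σ.Relations n) (s : Fin n → ESeq k A.carrier),
        (∀ i j, (s i).1 <+: (s j).1 ∨ (s j).1 <+: (s i).1) →
        (Language.Structure.RelMap R (fun i => (s i).last) ↔
          Language.Structure.RelMap R (fun i => h (s i)))) ∧
      ∀ s : Fin 2 → ESeq k A.carrier,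
        (∀ i j, (s i).1 <+: (s j).1 ∨ (s j).1 <+: (s i).1) →
        ((s 0).last = (s 1).last ↔ h (s 0) = h (s 1)) := by
  refine EFComonad.exists_isPathwise_iff.trans (exists_congr fun h => ⟨fun hh =>
    ⟨fun n R => hh n (Sum.inl R), hh 2 (Sum.inr IRel.I)⟩, fun hh n R => ?_⟩)
  match n, R with
  | n, Sum.inl R => exact hh.1 n R
  | _, Sum.inr IRel.I => exact hh.2

theorem EFComonad.exists_isPathwise_of_foSimulated {A B : Str.{u} σ}
    (h : FOSimulated σ k (default : Fin 0 → A.carrier) (default : Fin 0 → B.carrier)) :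
    ∃ f : EFCofreeI k A ⟶ EFCofreeI k B, EFComonad.IsPathwise f := by
  refine EFComonad.exists_isPathwise_cofreeI_iff.2 ?_
  -- A state is the pair of tuples chosen so far; each move appends one entry to both.
  let T := Σ n : ℕ, (Fin n → A.carrier) × (Fin n → B.carrier)
  obtain ⟨G, -, hG1, hG2⟩ := exists_unfolding (α := A.carrier) (β := B.carrier) (T := T)
    (fun l => l.length ≤ k) (fun l x hl => by rw [List.length_append] at hl; omega)
    (fun l t => FOSimulated σ (k - l.length) t.2.1 t.2.2)
    (fun t a b t' => t' = ⟨t.1 + 1, Fin.snoc t.2.1 a, Fin.snoc t.2.2 b⟩)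
    ⟨0, default, default⟩ h
    (fun l a t hl ht => by
      rw [List.length_append, List.length_singleton] at hl
      obtain ⟨j, hj⟩ : ∃ j, k - l.length = j + 1 := ⟨k - l.length - 1, by omega⟩
      rw [hj] at ht
      obtain ⟨b, hb⟩ := ht.2 a
      refine ⟨b, _, rfl, ?_⟩
      rwa [List.length_append, List.length_singleton, show k - (l.length + 1) = j by omega])
  have hval : ∀ s : ESeq k A.carrier, ∃ b, G s.1 = ⟨(G s.1.dropLast).1 + 1,
      Fin.snoc (G s.1.dropLast).2.1 s.last, Fin.snoc (G s.1.dropLast).2.2 b⟩ := fun s => by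
    have e : s.1.dropLast ++ [s.last] = s.1 := List.dropLast_append_getLast s.2.1
    obtain ⟨b, hb⟩ := hG2 s.1.dropLast s.last (e.symm ▸ s.2.2)
    refine ⟨b, ?_⟩
    conv_lhs => rw [← e]
    exact hb
  choose g hg using hval
  -- Nothing is overwritten here, so every prefix of `l` still has its entry in the tuples at `l`,
  -- and `SameAtoms` there settles all relations on the chain.
  have key : ∀ l : List A.carrier, l.length ≤ k → ∀ s : ESeq k A.carrier, s.1 <+: l →
      ∃ i : Fin (G l).1, (G l).2.1 i = s.last ∧ (G l).2.2 i = g s := by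
    intro l
    induction l using List.reverseRecOn with
    | nil => exact fun _ s hs => absurd (List.prefix_nil.1 hs) s.2.1
    | append_singleton l a ih =>
      intro hl s hs
      let s' : ESeq k A.carrier := ⟨l ++ [a], by simp, hl⟩
      have hs1 : s'.1.dropLast = l := List.dropLast_concat
      have hs2 : s'.last = a := List.getLast_append_singleton _
      have hGm := hg s'
      rw [hs1, hs2] at hGm
      change G (l ++ [a]) = _ at hGm
      rw [hGm]
      rw [List.prefix_concat_iff] at hs
      rcases hs with hs | hs
      · obtain rfl : s = s' := Subtype.ext hs
        exact ⟨Fin.last _, (Fin.snoc_last (α := fun _ => A.carrier) ..).trans hs2.symm,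
          Fin.snoc_last (α := fun _ => B.carrier) ..⟩
      · rw [List.length_append] at hl
        obtain ⟨i, hi1, hi2⟩ := ih (by omega) s hs
        exact ⟨i.castSucc, (Fin.snoc_castSucc (α := fun _ => A.carrier) ..).trans hi1,
          (Fin.snoc_castSucc (α := fun _ => B.carrier) ..).trans hi2⟩
  have ext : ∀ {n : ℕ} (s : Fin n → ESeq k A.carrier),
      (∀ i j, (s i).1 <+: (s j).1 ∨ (s j).1 <+: (s i).1) →
      ∃ l : List A.carrier, l.length ≤ k ∧ ∀ i, (s i).1 <+: l := fun s hs => by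
    rcases exists_common_extension (fun i => (s i).1) hs with rfl | ⟨j, hj⟩
    · exact ⟨[], Nat.zero_le _, fun i => i.elim0⟩
    · exact ⟨_, (s j).2.2, hj⟩
  refine ⟨g, fun n R s hs => ?_, fun s hs => ?_⟩
  all_goals
    obtain ⟨l, hk, hl⟩ := ext s hs
    choose i hi1 hi2 using fun j => key l hk (s j) (hl j)
    simp only [← hi1, ← hi2]
  · exact (hG1 l hk).sameAtoms.relMap_iff R i
  · exact (hG1 l hk).sameAtoms.eq_iff (i 0) (i 1)

theorem exists_var_of_isRelational {n : ℕ} (t : σ.Term (Empty ⊕ Fin n)) :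
    ∃ i, t = .var (.inr i) := by
  match t with
  | .var (.inr i) => exact ⟨i, rfl⟩
  | .func f _ => exact isEmptyElim f

/-- In a relational vocabulary every term is a variable. -/
theorem exists_atom_of_isAtomic {n : ℕ} {φ : σ.BoundedFormula Empty n} (h : φ.IsAtomic) :
    ∃ t : FOAtom σ n, φ = t.toFormula := by
  cases h with
  | equal t₁ t₂ =>
    obtain ⟨i, rfl⟩ := exists_var_of_isRelational t₁
    obtain ⟨j, rfl⟩ := exists_var_of_isRelational t₂
    exact ⟨.inr (i, j), rfl⟩
  | rel R ts =>
    choose x hx using fun i => exists_var_of_isRelational (ts i)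
    obtain rfl : ts = _ := funext hx
    exact ⟨.inl ⟨⟨_, R⟩, x⟩, rfl⟩

theorem EFComonad.preservesExistsFO_of_isPathwise {A B : Str.{u} σ}
    (h : ∃ f : EFCofreeI k A ⟶ EFCofreeI k B, EFComonad.IsPathwise f) :
    PreservesExistsFO k A B := by
  obtain ⟨h, hh, hh'⟩ := EFComonad.exists_isPathwise_cofreeI_iff.1 h
  -- Variables stand for prefixes of one play `l`, and the bound reserves a round for each nested
  -- quantifier of φ.
  suffices key : ∀ (n : ℕ) (φ : σ.BoundedFormula Empty n), IsExistentialFO φ →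
      ∀ (l : List A.carrier) (q : Fin n → ESeq k A.carrier), (∀ i, (q i).1 <+: l) →
        l.length + quantifierRank φ ≤ k →
        φ.Realize default (fun i => (q i).last) → φ.Realize default (fun i => h (q i)) by
    intro φ hφ hA
    have := key 0 φ hφ.1 [] Fin.elim0 (fun i => i.elim0) ((Nat.zero_add _).trans_le hφ.2)
    rw [Subsingleton.elim (fun i : Fin 0 => ESeq.last _) default,
      Subsingleton.elim (fun i : Fin 0 => h _) default] at this
    exact this hA
  intro n φ hφ
  have hatom : ∀ {n : ℕ} {φ : σ.BoundedFormula Empty n}, φ.IsAtomic →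
      ∀ (l : List A.carrier) (q : Fin n → ESeq k A.carrier), (∀ i, (q i).1 <+: l) →
        (φ.Realize default (fun i => (q i).last) ↔ φ.Realize default (fun i => h (q i))) := by
    intro n φ hφ l q hq
    obtain ⟨t, rfl⟩ := exists_atom_of_isAtomic hφ
    rcases t with ⟨⟨m, R⟩, x⟩ | ⟨i, j⟩
    · simpa [FOAtom.toFormula, Language.BoundedFormula.realize_rel] using
        hh m R (fun i => q (x i)) fun i j => List.prefix_or_prefix_of_prefix (hq _) (hq _)
    · simpa [FOAtom.toFormula] using
        hh' (fun m => q (![i, j] m)) fun i j => List.prefix_or_prefix_of_prefix (hq _) (hq _)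
  induction hφ with
  | verum => exact fun _ _ _ _ h => h
  | falsum => exact fun _ _ _ _ h => h
  | atom hφ => exact fun l q hq _ => (hatom hφ l q hq).1
  | neg_atom hφ =>
    intro l q hq _
    simp only [Language.BoundedFormula.realize_not]
    exact (not_congr (hatom hφ l q hq)).1
  | @and n φ ψ _ _ ih1 ih2 =>
    intro l q hq hk
    change _ + max (max (quantifierRank φ) (max (quantifierRank ψ) 0)) 0 ≤ k at hk
    simp only [Language.BoundedFormula.realize_inf]
    exact And.imp (ih1 l q hq (by omega)) (ih2 l q hq (by omega))
  | @or n φ ψ _ _ ih1 ih2 =>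
    intro l q hq hk
    change _ + max (max (quantifierRank φ) 0) (quantifierRank ψ) ≤ k at hk
    simp only [Language.BoundedFormula.realize_sup]
    exact Or.imp (ih1 l q hq (by omega)) (ih2 l q hq (by omega))
  | @ex n φ _ ih =>
    intro l q hq hk
    rw [quantifierRank_ex] at hk
    simp only [Language.BoundedFormula.realize_ex]
    rintro ⟨a, ha⟩
    -- Extending the whole play `l` keeps all earlier prefixes below `s`; its length is at most k
    -- because an existential has rank at least one.
    let s : ESeq k A.carrier := ⟨l ++ [a], by simp, by simp; omega⟩
    have hs : s.last = a := List.getLast_append_singleton _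
    have hc : ∀ {D : Type u} (f : ESeq k A.carrier → D),
        (fun i => f ((Fin.snoc q s : Fin (n + 1) → ESeq k A.carrier) i)) =
          Fin.snoc (fun i => f (q i)) (f s) := fun f => Fin.comp_snoc f q s
    have := ih s.1 (Fin.snoc q s) ?_ ?_
    · rw [hc, hc, hs] at this
      exact ⟨h s, this ha⟩
    · intro i
      refine Fin.lastCases ?_ (fun i => ?_) i
      · rw [Fin.snoc_last]
      · rw [Fin.snoc_castSucc]
        exact (hq i).trans (List.prefix_append _ _)
    · simp only [s, List.length_append, List.length_singleton]
      omega

end FO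

end GameComonads

open GameComonads
theorem mainTheorem1 (σ : FirstOrder.Language.{0, 0}) [σ.IsRelational]
    (hσ : Finite (Σ n, σ.Relations n)) (k : ℕ) :
    (∀ A B : Str.{u} σ,
      PreservesExistsFO k A B ↔ ∃ f : EFCofreeI k A ⟶ EFCofreeI k B, EFComonad.IsPathwise f) ∧
    (0 < k → ∀ A B : Str.{u} σ,
      PreservesExistsL k A B ↔ ∃ f : PebCofreeI k A ⟶ PebCofreeI k B, PebComonad.IsPathwise f) ∧
    (IsModal σ → ∀ A B : PStr.{u} σ,
      PreservesExistsML k A B ↔ ∃ f : ModCofree k A ⟶ ModCofree k B, ModComonad.IsPathwise f) :=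
  ⟨fun _ _ => ⟨fun h =>
      EFComonad.exists_isPathwise_of_foSimulated (foSimulated_of_preservesExistsFO hσ h),
      EFComonad.preservesExistsFO_of_isPathwise⟩,
    fun _ _ _ => ⟨PebComonad.exists_isPathwise_of_preservesExistsL,
      PebComonad.preservesExistsL_of_isPathwise⟩,
    fun _ _ _ => ⟨fun h =>
      ModComonad.exists_isPathwise_of_modalSimulated (modalSimulated_of_preservesExistsML hσ h),
      ModComonad.preservesExistsML_of_isPathwise⟩⟩
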